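/- Conventions. For a locally compact (Hausdorff) group $G$ with left Haar measure $ds$, let $\lambda$ be the left regular representation, $(\lambda_s\xi)(g)=\xi(s^{-1}g)$ on $L^2(G)$. Let $M(G)$ be the space of regular complex Borel measures on $G$. For $\mu\in M(G)$ put $\lambda(\mu)=\int_G\lambda_s\,d\mu(s)$, and for $f\in L^1(G)$ put $\lambda(f)=\int_G f(s)\lambda_s\,ds$. Let $C_r^*(G)$ be the operator-norm closure of $\{\lambda(f): f\in L^1(G)\}$, and let $A(G)=\{s\mapsto(\lambda_s\xi,\eta):\xi,\eta\in L^2(G)\}$. For a closed set $E\subseteq G$ let $M(E)$ be the set of those $\mu\in M(G)$ whose support is contained in $E$. The closed set $E$ is an $M_0$-set if $\lambda(M(E))\cap C_r^*(G)\neq\{0\}$. (If $G$ is abelian, the measures $\mu\in M(G)$ with $\lambda(\mu)\in C_r^*(G)$ are exactly the Rajchman measures.) For a closed normal subgroup $H$ of $G$ with left Haar measure $dh$ and a function $f$ on $G$ put $\phi(f)(xH)=\int_H f(xh)\,dh$. The subgroup $H$ has property $(|l|^2)$ if for every compact $K\subsetneq G/H$ there are $\theta\in A(G)\cap C_c(G)$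 and real constants $c_1,c_2>0$ such that $\phi(|\theta|)=c_1$ and $\phi(\theta^2)=c_2$ on a neighbourhood of $K$. Theorem. Let $G$ be a locally compact group and $H\subseteq G$ a closed normal subgroup with property $(|l|^2)$ such that $G/H$ is abelian and second countable. Let $q:G\to G/H$ be the quotient map and let $E\subseteq G/H$ be a compact $M_0$-set. Then $q^{-1}(E)$ is an $M_0$-set. Moreover, there are a measure $\mu\in M(E)$ with $0\neq\lambda(\mu)\in C_r^*(G/H)$ (that is, a nonzero Rajchman measure), a function $\theta\in A(G)\cap C_c(G)$, and a measure $\nu\in M(q^{-1}(E))$ with $0\neq\lambda(\nu)\in C_r^*(G)$, such that $$\int_G u\,d\nu=\int_{G/H}\phi(\theta u)\,d\mu\qquad\text{for all }u\in A(G),$$ i.e. $\lambda(\nu)=\Phi_\theta(\lambda(\mu))$, where $\langle\Phi_\theta(T),u\rangle=\langle T,\phi(\theta u)\rangle$ for $T$ in the group von Neumann algebra of $G/H$ and $u\in A(G)$. -/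

import Mathlib

open MeasureTheory MeasureTheory.Measure Topology
open scoped ENNReal

noncomputable section

section Group

variable (G : Type*) [Group G] [TopologicalSpace G] [IsTopologicalGroup G] [LocallyCompactSpace G]
  [MeasurableSpace G] [BorelSpace G]

/-- The Hilbert space `L²(G)` with respect to (left) Haar measure. -/
abbrev HaarL2 : Type _ := Lp ℂ 2 (haar : Measure G)

variable {G}

/-- The left regular representation, `(λ_s ξ)(g) = ξ(s⁻¹ g)` for almost every `g`. -/
def leftRegular (s : G) : HaarL2 G →ₗᵢ[ℂ] HaarL2 G :=
  Lp.compMeasurePreservingₗᵢ ℂ (fun g : G => s⁻¹ * g) (measurePreserving_mul_left haar s⁻¹)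

/-- The coefficient function `s ↦ (λ_s ξ, η)` of the left regular representation; Mathlib's inner
product is conjugate-linear in its first argument. -/
def regularCoeff (ξ η : HaarL2 G) (s : G) : ℂ := inner ℂ η (leftRegular s ξ)

variable (G) in
/-- The Fourier algebra `A(G)`, as a set of functions: all coefficients of the left regular
representation. -/
def fourierAlgebra : Set (G → ℂ) := {u | ∃ ξ η : HaarL2 G, u = regularCoeff ξ η}

/-- The integral `∫ u dμ` of a complex function against a complex measure. -/
def cintegral (μ : ComplexMeasure G) (u : G → ℂ) : ℂ :=
  μ.integral u (ContinuousLinearMap.mul ℝ ℂ)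

/-- `M(E)`: the regular complex Borel measures on `G` whose support, that is, the support of their
total variation, is contained in `E`. Here `M(G)` is the case `E = G`. -/
def measuresOn (E : Set G) : Set (ComplexMeasure G) :=
  {μ | μ.variation.Regular ∧ μ.variation.support ⊆ E}

/-- `T = λ(μ)`, where `λ(μ) = ∫ λ_s dμ(s)` as a weak integral: the operator determined by
`(λ(μ) ξ, η) = ∫ (λ_s ξ, η) dμ(s)`. -/
def IsRegularOp (μ : ComplexMeasure G) (T : HaarL2 G →L[ℂ] HaarL2 G) : Prop :=
  ∀ ξ η : HaarL2 G, inner ℂ η (T ξ) = cintegral μ (regularCoeff ξ η)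

variable (G) in
/-- The reduced group C⋆-algebra `C_r⋆(G)`: the closure in operator norm of the operators `λ(f)`
with `f ∈ L¹(G)`, where `(λ(f) ξ, η) = ∫ f(s) (λ_s ξ, η) ds`. -/
def reducedCStar : Set (HaarL2 G →L[ℂ] HaarL2 G) :=
  closure {T | ∃ f : G → ℂ, Integrable f (haar : Measure G) ∧
    ∀ ξ η : HaarL2 G, inner ℂ η (T ξ) = ∫ s, f s * regularCoeff ξ η s ∂(haar : Measure G)}

/-- `μ ∈ M(E)` with `0 ≠ λ(μ) ∈ C_r⋆(G)`. If `G` is abelian, then these are the nonzero Rajchman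
measures supported by `E`. -/
def IsM0Witness (E : Set G) (μ : ComplexMeasure G) : Prop :=
  μ ∈ measuresOn E ∧ ∃ T ∈ reducedCStar G, IsRegularOp μ T ∧ T ≠ 0

/-- `M₀`-sets (sets of restricted multiplicity): the closed sets `E` with
`λ(M(E)) ∩ C_r⋆(G) ≠ {0}`. -/
def IsM0Set (E : Set G) : Prop := IsClosed E ∧ ∃ μ : ComplexMeasure G, IsM0Witness E μ

end Group

section Quotient

variable {G : Type*} [Group G] [TopologicalSpace G] [IsTopologicalGroup G] [LocallyCompactSpace G]
  [MeasurableSpace G] [BorelSpace G]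

/-- Haar measure on a closed subgroup. -/
def subgroupHaar (H : Subgroup G) (hH : IsClosed (H : Set G)) : Measure H :=
  haveI : LocallyCompactSpace H := hH.isClosedEmbedding_subtypeVal.locallyCompactSpace
  haar

theorem subgroupHaar_isHaarMeasure (H : Subgroup G) (hH : IsClosed (H : Set G)) :
    (subgroupHaar H hH).IsHaarMeasure := by
  have : LocallyCompactSpace H := hH.isClosedEmbedding_subtypeVal.locallyCompactSpace
  exact (inferInstance : (haar : Measure H).IsHaarMeasure)

/-- The averaging map `φ(f)(xH) = ∫_H f(xh) dh`. -/
def cosetAverage (H : Subgroup G) (hH : IsClosed (H : Set G)) (f : G → ℂ) (x : G ⧸ H) : ℂ :=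
  Quotient.liftOn' x (fun y : G => ∫ h : H, f (y * h) ∂(subgroupHaar H hH)) (by
    have := subgroupHaar_isHaarMeasure H hH
    intro a b hab
    have hab' : a⁻¹ * b ∈ H := QuotientGroup.leftRel_apply.1 hab
    have key := integral_mul_left_eq_self (μ := subgroupHaar H hH)
      (fun h : H => f (a * h)) (⟨a⁻¹ * b, hab'⟩ : H)
    simpa [mul_assoc] using key.symm)

/-- Property `(|l|²)` of a closed normal subgroup `H` of `G`: for every compact `K ⊊ G/H` there is
`θ ∈ A(G) ∩ C_c(G)` such that, on a neighbourhood of `K`, `φ(|θ|)` and `φ(θ²)` are constant with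
positive values. -/
def HasPropertyLSq (H : Subgroup G) (hH : IsClosed (H : Set G)) : Prop :=
  ∀ K : Set (G ⧸ H), IsCompact K → K ≠ Set.univ →
    ∃ θ ∈ fourierAlgebra G, Continuous θ ∧ HasCompactSupport θ ∧
      ∃ c₁ c₂ : ℝ, 0 < c₁ ∧ 0 < c₂ ∧ ∀ᶠ x in 𝓝ˢ K,
        cosetAverage H hH (fun y => (‖θ y‖ : ℂ)) x = c₁ ∧
        cosetAverage H hH (fun y => θ y ^ 2) x = c₂

end Quotient

end

/-! Multiplying by a fixed coefficient θ of G and averaging over H sends coefficients of G to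
functions on G/H; dually, an operator T over G/H is transported to Φ_θ(T) over G. The transport
preserves membership in the reduced C⋆-algebra for two reasons. First, it is bounded. If θ is the
coefficient of ξ, η ∈ C_c(G), then θ·(λ_s f, g) is the integral over r of the coefficients of t ↦
ξ(t)f(tr) and t ↦ η(t)g(tr) (`ccoeff_mul_ccoeff`). The average of a coefficient is a multiple of the
coefficient of the averaged vectors (`cosetAverage_ccoeff`). Averaging functions supported in a
fixed compact set is L²-bounded, so integration over r gives a bound by ‖T‖
(`exists_norm_cosetAverage_mul_ccoeff_le`). Second, by Weil's formula Φ_θ(λ(f₀)) = λ(κ⁻¹ (f₀ ∘ q) θ)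
for f₀ ∈ C_c(G/H). Norm approximation of T by such λ(f₀) therefore passes to G
(`mem_reducedCStar_of_inner_eq`). When θ ≥ 0, each positive part p of μ yields a positive measure w
↦ ∫ φ(θw) dp on G, by the Riesz representation theorem; these combine to ν. For ν ≠ 0 it suffices
that ∫ φ(θ) dμ ≠ 0. Since φ maps the nonnegative functions of C_c(G) onto those of C_c(G/H), θ can
be lifted from a coefficient on G/H that λ(μ) does not annihilate
(`exists_ccoeff_cosetAverage_ne_zero`). -/

/-! ### Complex measures as combinations of finite positive measures -/

section ComplexMeasure

variable {X : Type*} [MeasurableSpace X]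

/-- The complex measure `c • p`, for a finite positive measure `p`. -/
noncomputable def scaledMeasure (p : Measure X) [IsFiniteMeasure p] (c : ℂ) : ComplexMeasure X :=
  p.toSignedMeasure.mapRange (ContinuousLinearMap.toSpanSingleton ℝ c).toLinearMap.toAddMonoidHom
    (ContinuousLinearMap.toSpanSingleton ℝ c).continuous

theorem scaledMeasure_apply (p : Measure X) [IsFiniteMeasure p] (c : ℂ) {s : Set X}
    (hs : MeasurableSet s) : scaledMeasure p c s = (p.real s : ℂ) * c := by
  simp [scaledMeasure, hs]

theorem variation_scaledMeasure_le (p : Measure X) [IsFiniteMeasure p] {c : ℂ} (hc : ‖c‖ ≤ 1) :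
    (scaledMeasure p c).variation ≤ p := by
  refine VectorMeasure.variation_le_of_forall_enorm_le fun s hs => ?_
  rw [scaledMeasure_apply p c hs, enorm_mul]
  calc ‖(p.real s : ℂ)‖ₑ * ‖c‖ₑ ≤ ‖(p.real s : ℂ)‖ₑ * 1 := by
        gcongr
        rw [← ofReal_norm]
        exact ENNReal.ofReal_le_one.2 hc
    _ = p s := by
        rw [mul_one, ← ofReal_norm, Complex.norm_real, Real.norm_of_nonneg measureReal_nonneg,
          ofReal_measureReal]

theorem cintegral_scaledMeasure [TopologicalSpace X] [BorelSpace X] (p : Measure X)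
    [IsFiniteMeasure p] {c : ℂ} (hc : ‖c‖ ≤ 1)
    {u : X → ℂ} (hu : Integrable u p) : cintegral (scaledMeasure p c) u = c * ∫ x, u x ∂p := by
  have hle := variation_scaledMeasure_le p hc
  have hint : ∀ {v : X → ℂ}, Integrable v p → (scaledMeasure p c).Integrable v :=
    fun hv => hv.mono_measure hle
  have : IsFiniteMeasure (scaledMeasure p c).variation := isFiniteMeasure_of_le _ hle
  refine Integrable.induction (P := fun u => cintegral (scaledMeasure p c) u = c * ∫ x, u x ∂p)
    ?_ ?_ ?_ ?_ hu
  · intro a s hs hfin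
    unfold cintegral
    rw [VectorMeasure.integral_eq_setToFun, setToFun_indicator_const _ hs (by finiteness),
      integral_indicator_const _ hs, MeasureTheory.transpose_eq_cbmApplyMeasure,
      cbmApplyMeasure_apply, scaledMeasure_apply _ _ hs]
    simp
    ring
  · intro f g hd hf hg h1 h2
    unfold cintegral at *
    rw [VectorMeasure.integral_add (hint hf) (hint hg), h1, h2, ← mul_add]
    congr 1
    exact (integral_add hf hg).symm
  -- Both sides are L¹(p)-continuous: the variation of the scaled measure is at most p.
  · have h1 : Continuous fun f : X →₁[p] ℂ => cintegral (scaledMeasure p c) f := by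
      have := continuous_setToFun (μ := p) (T := (scaledMeasure p c).transpose
          (ContinuousLinearMap.mul ℝ ℂ)) ((dominatedFinMeasAdditive_cbmApplyMeasure
            (scaledMeasure p c) (ContinuousLinearMap.mul ℝ ℂ)).of_measure_le hle
              (norm_nonneg (ContinuousLinearMap.mul ℝ ℂ)))
      refine this.congr fun f => ?_
      unfold cintegral
      rw [VectorMeasure.integral_eq_setToFun]
      exact (setToFun_congr_measure_of_integrable 1 (by simp) (by simpa using hle) _ _ _
        (L1.integrable_coeFn f))
    exact isClosed_eq h1 (continuous_const.mul continuous_integral)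
  · intro f g hfg hf h
    unfold cintegral at *
    rw [← integral_congr_ae hfg, ← h]
    exact (VectorMeasure.integral_congr_ae (hle.absolutelyContinuous.ae_le hfg)).symm

theorem cintegral_sum_scaledMeasure [TopologicalSpace X] [BorelSpace X] {ι : Type*} [Fintype ι]
    (p : ι → Measure X) [∀ k, IsFiniteMeasure (p k)] {c : ι → ℂ} (hc : ∀ k, ‖c k‖ ≤ 1)
    {u : X → ℂ} (hu : ∀ k, Integrable u (p k)) :
    cintegral (∑ k, scaledMeasure (p k) (c k)) u = ∑ k, c k * ∫ x, u x ∂(p k) := by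
  unfold cintegral
  rw [VectorMeasure.integral_finsetSum_vectorMeasure fun k _ =>
    (hu k).mono_measure (variation_scaledMeasure_le (p k) (hc k))]
  exact Finset.sum_congr rfl fun k _ => cintegral_scaledMeasure (p k) (hc k) (hu k)

theorem variation_sum_scaledMeasure_le {ι : Type*} [Fintype ι]
    (p : ι → Measure X) [∀ k, IsFiniteMeasure (p k)] {c : ι → ℂ} (hc : ∀ k, ‖c k‖ ≤ 1) :
    (∑ k, scaledMeasure (p k) (c k)).variation ≤ ∑ k, p k :=
  (VectorMeasure.variation_finsetSum_le _ _).trans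
    (Finset.sum_le_sum fun k _ => variation_scaledMeasure_le (p k) (hc k))

/-- The Jordan decomposition of a complex measure. -/
theorem exists_eq_sum_scaledMeasure (μ : ComplexMeasure X) :
    ∃ (p : Fin 4 → Measure X) (_ : ∀ k, IsFiniteMeasure (p k)) (c : Fin 4 → ℂ),
      (∀ k, ‖c k‖ ≤ 1) ∧ (∀ k, p k ≤ μ.variation) ∧ μ = ∑ k, scaledMeasure (p k) (c k) := by
  have hle : ∀ s : SignedMeasure X, (∀ i, ‖s i‖ₑ ≤ ‖μ i‖ₑ) →
      s.toJordanDecomposition.posPart ≤ μ.variation ∧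
      s.toJordanDecomposition.negPart ≤ μ.variation := by
    intro s hs
    have h1 : s.totalVariation ≤ μ.variation := by
      rw [SignedMeasure.totalVariation_eq_variation]
      exact VectorMeasure.variation_le_of_forall_enorm_le fun i _ =>
        (hs i).trans (VectorMeasure.enorm_measure_le_variation _ _)
    exact ⟨(Measure.le_add_right le_rfl).trans h1, (Measure.le_add_left le_rfl).trans h1⟩
  have hre := hle (ComplexMeasure.re μ) fun i => by
    rw [← ofReal_norm, ← ofReal_norm]
    exact ENNReal.ofReal_le_ofReal (Complex.abs_re_le_norm _)
  have him := hle (ComplexMeasure.im μ) fun i => by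
    rw [← ofReal_norm, ← ofReal_norm]
    exact ENNReal.ofReal_le_ofReal (Complex.abs_im_le_norm _)
  have hS : ∀ (s : SignedMeasure X) {i : Set X}, MeasurableSet i →
      s i = s.toJordanDecomposition.posPart.real i - s.toJordanDecomposition.negPart.real i := by
    intro s i hi
    conv_lhs => rw [← s.toSignedMeasure_toJordanDecomposition]
    simp [JordanDecomposition.toSignedMeasure, hi]
  refine ⟨![(ComplexMeasure.re μ).toJordanDecomposition.posPart,
    (ComplexMeasure.re μ).toJordanDecomposition.negPart,
    (ComplexMeasure.im μ).toJordanDecomposition.posPart,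
    (ComplexMeasure.im μ).toJordanDecomposition.negPart], ?_,
    ![1, -1, Complex.I, -Complex.I], ?_, ?_, ?_⟩
  · simp only [Fin.forall_fin_succ, IsEmpty.forall_iff, and_true]
    exact ⟨JordanDecomposition.posPart_finite _, JordanDecomposition.negPart_finite _,
      JordanDecomposition.posPart_finite _, JordanDecomposition.negPart_finite _⟩
  · intro k; fin_cases k <;> simp
  · intro k; fin_cases k
    exacts [hre.1, hre.2, him.1, him.2]
  · ext i hi
    have h1 : (μ i).re = _ := hS (ComplexMeasure.re μ) hi
    have h2 : (μ i).im = _ := hS (ComplexMeasure.im μ) hi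
    apply Complex.ext
    · simpa [Fin.sum_univ_four, scaledMeasure_apply, hi, sub_eq_add_neg] using h1
    · simpa [Fin.sum_univ_four, scaledMeasure_apply, hi, sub_eq_add_neg] using h2

end ComplexMeasure

/-! ### Regularity of dominated measures -/

section Regular

variable {X : Type*} [TopologicalSpace X] [T2Space X] [MeasurableSpace X] [BorelSpace X]

/-- A compact K ⊆ A with m(A \ K) < v(A) - r also has v(A \ K) < v(A) - r, which forces v(K) > r. -/
theorem Measure.Regular.of_le_of_isFiniteMeasure {v m : Measure X} [IsFiniteMeasure m]
    [m.InnerRegular] (h : v ≤ m) : v.Regular := by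
  have : IsFiniteMeasure v := isFiniteMeasure_of_le _ h
  have : v.InnerRegular := ⟨fun A hA r hr => by
    obtain ⟨K, hKA, hK, hlt⟩ := hA.exists_isCompact_sdiff_lt (μ := m) (by finiteness)
      (tsub_pos_of_lt hr).ne'
    refine ⟨K, hKA, hK, ?_⟩
    have h1 : v A ≤ v K + v (A \ K) := by
      rw [← Set.union_sdiff_cancel hKA]
      exact (measure_union_le _ _).trans (by rw [Set.union_sdiff_cancel hKA])
    have h2 : v (A \ K) < v A - r := (h _).trans_lt hlt
    by_contra! hc
    have h3 : v K + v (A \ K) < r + (v A - r) :=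
      ENNReal.add_lt_add_of_le_of_lt (by finiteness) hc h2
    rw [add_tsub_cancel_of_le hr.le] at h3
    exact absurd h1 h3.not_ge⟩
  infer_instance

end Regular

/-! ### Continuous functions with compact support -/

section Cc

/-- Continuous complex functions with compact support. -/
def IsCc {X : Type*} [TopologicalSpace X] (f : X → ℂ) : Prop := Continuous f ∧ HasCompactSupport f

variable {X Y : Type*} [TopologicalSpace X] [TopologicalSpace Y]

theorem IsCc.of_forall_notMem [R1Space X] {f : X → ℂ} {K : Set X} (hf : Continuous f)
    (hK : IsCompact K) (h : ∀ x, x ∉ K → f x = 0) : IsCc f :=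
  ⟨hf, HasCompactSupport.intro hK h⟩

theorem IsCc.apply_eq_zero {f : X → ℂ} {x : X} (hx : x ∉ tsupport f) : f x = 0 :=
  image_eq_zero_of_notMem_tsupport hx

theorem IsCc.mul_left {f g : X → ℂ} (hf : IsCc f) (hg : Continuous g) :
    IsCc fun x => g x * f x := ⟨hg.mul hf.1, hf.2.mul_left⟩

theorem IsCc.mul_right {f g : X → ℂ} (hf : IsCc f) (hg : Continuous g) :
    IsCc fun x => f x * g x := ⟨hf.1.mul hg, hf.2.mul_right⟩

theorem IsCc.comp_homeomorph {f : X → ℂ} (hf : IsCc f) (e : Y ≃ₜ X) : IsCc fun y => f (e y) :=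
  ⟨hf.1.comp e.continuous, hf.2.comp_homeomorph e⟩

theorem IsCc.comp_isClosedEmbedding {f : X → ℂ} (hf : IsCc f) {e : Y → X}
    (he : IsClosedEmbedding e) : IsCc fun y => f (e y) :=
  ⟨hf.1.comp he.continuous, hf.2.comp_isClosedEmbedding he⟩

theorem IsCc.star {f : X → ℂ} (hf : IsCc f) : IsCc fun x => (starRingEnd ℂ) (f x) :=
  ⟨Complex.continuous_conj.comp hf.1, hf.2.comp_left (g := starRingEnd ℂ) (map_zero _)⟩

theorem IsCc.normSq {f : X → ℂ} (hf : IsCc f) : IsCc fun x => ((‖f x‖ ^ 2 : ℝ) : ℂ) :=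
  ⟨Complex.continuous_ofReal.comp (hf.1.norm.pow 2),
    hf.2.comp_left (g := fun z : ℂ => ((‖z‖ ^ 2 : ℝ) : ℂ)) (by simp)⟩

theorem IsCc.integrable [MeasurableSpace X] [OpensMeasurableSpace X] {μ : Measure X}
    [IsFiniteMeasureOnCompacts μ] {f : X → ℂ} (hf : IsCc f) : Integrable f μ :=
  hf.1.integrable_of_hasCompactSupport hf.2

theorem IsCc.integral_prod [R1Space X] [MeasurableSpace Y] [OpensMeasurableSpace Y] {μ : Measure Y}
    [IsFiniteMeasureOnCompacts μ] {F : X → Y → ℂ} (hF : IsCc F.uncurry) :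
    IsCc fun x => ∫ y, F x y ∂μ := by
  have h0 : ∀ x y, (x, y) ∉ tsupport F.uncurry → F x y = 0 := fun x y h =>
    IsCc.apply_eq_zero (f := F.uncurry) h
  refine IsCc.of_forall_notMem ?_ (hF.2.isCompact.image continuous_fst) fun x hx => ?_
  · rw [← continuousOn_univ]
    refine continuousOn_integral_of_compact_support (hF.2.isCompact.image continuous_snd)
      hF.1.continuousOn fun x y _ hy => h0 x y fun h => hy ⟨_, h, rfl⟩
  · simp [fun y => h0 x y fun h => hx ⟨_, h, rfl⟩]

/-- Compact joint support replaces σ-finiteness, so that Fubini applies to Haar measure on any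
locally compact group. -/
theorem IsCc.integral_integral_swap [MeasurableSpace X] [OpensMeasurableSpace X]
    [MeasurableSpace Y] [OpensMeasurableSpace Y] {μ : Measure X} {ν : Measure Y}
    [IsFiniteMeasureOnCompacts μ] [IsFiniteMeasureOnCompacts ν] {F : X → Y → ℂ}
    (hF : IsCc F.uncurry) : ∫ x, ∫ y, F x y ∂ν ∂μ = ∫ y, ∫ x, F x y ∂μ ∂ν :=
  integral_integral_swap_of_hasCompactSupport hF.1 hF.2

theorem IsCc.exists_bound {f : X → ℂ} (hf : IsCc f) : ∃ C, ∀ x, ‖f x‖ ≤ C :=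
  hf.1.bounded_above_of_compact_support hf.2

end Cc

/-! ### Density in Lᵖ -/

section Density

variable {X : Type*} [TopologicalSpace X] [T2Space X] [LocallyCompactSpace X] [MeasurableSpace X]
  [BorelSpace X]

/-- Density of the continuous functions with compact support in `Lᵖ`, without normality. -/
theorem exists_isCc_eLpNorm_sub_le {μ : Measure X} [μ.Regular] {p : ℝ≥0∞} (hp : p ≠ ∞)
    {f : X → ℂ} (hf : MemLp f p μ) {ε : ℝ≥0∞} (hε : ε ≠ 0) :
    ∃ g : X → ℂ, eLpNorm (f - g) p μ ≤ ε ∧ IsCc g := by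
  refine hf.induction_dense hp IsCc ?_ ?_ ?_ hε
  · intro c t ht htμ ε hε
    obtain ⟨η, ηpos, hη⟩ := exists_eLpNorm_indicator_le (μ := μ) hp c hε
    have hη2 : (η / 2 : ℝ≥0∞) ≠ 0 := by simpa using ηpos.ne'
    -- With s ⊆ t compact and V ⊇ s open, a bump function that is 1 on s and supported in V differs
    -- from the indicator of t only on (V \ s) ∪ (t \ s).
    obtain ⟨s, st, hs, hts⟩ := ht.exists_isCompact_sdiff_lt htμ.ne hη2
    obtain ⟨V, sV, hV, -, hVs⟩ := hs.measurableSet.exists_isOpen_sdiff_lt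
      (hs.measure_lt_top (μ := μ)).ne hη2
    obtain ⟨g, hg1, hgc, hgV, hg01⟩ := exists_continuousMap_one_of_isCompact_subset_isOpen hs hV sV
    refine ⟨fun x => (g x : ℂ) * c, ?_, IsCc.mul_right ⟨by fun_prop, ?_⟩ continuous_const⟩
    · refine (eLpNorm_mono fun x => ?_).trans (hη (V \ s ∪ t \ s) ?_)
      · have h01 : ‖(g x : ℂ)‖ ≤ 1 := by
          rw [Complex.norm_real, Real.norm_of_nonneg (hg01 x).1]
          exact (hg01 x).2
        by_cases hxs : x ∈ s
        · simp [hg1 hxs, st hxs]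
        by_cases hxt : x ∈ t
        · have h2 : ‖(g x : ℂ) * c - c‖ ≤ ‖c‖ := by
            have : (g x : ℂ) * c - c = ((g x - 1 : ℝ) : ℂ) * c := by push_cast; ring
            rw [this, norm_mul, Complex.norm_real]
            refine mul_le_of_le_one_left (norm_nonneg _) ?_
            rw [Real.norm_eq_abs, abs_le]
            exact ⟨by linarith [(hg01 x).1], by linarith [(hg01 x).2]⟩
          simpa [hxs, hxt] using h2
        by_cases hxV : x ∈ V
        · simpa [hxs, hxt, hxV] using mul_le_of_le_one_left (norm_nonneg c) h01
        · have : g x = 0 := image_eq_zero_of_notMem_tsupport fun h => hxV (hgV h)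
          simp [hxt, this]
      · refine (measure_union_le _ _).trans ((add_le_add hVs.le hts.le).trans ?_)
        rw [ENNReal.add_halves]
    · exact HasCompactSupport.comp_left (g := fun r : ℝ => (r : ℂ)) hgc (by simp)
  · exact fun f g hf hg => ⟨hf.1.add hg.1, hf.2.add hg.2⟩
  · exact fun f hf => (hf.1.memLp_of_hasCompactSupport (p := p) (μ := μ) hf.2).aestronglyMeasurable

end Density

/-! ### Operators from sesquilinear forms, and a norm criterion -/

section Hilbert

variable {E : Type*} [NormedAddCommGroup E] [InnerProductSpace ℂ E]

theorem exists_clm_inner_eq [CompleteSpace E] (B : E → E → ℂ) (hadd : ∀ x x' y, B (x + x') y = B x y + B x' y)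
    (hsmul : ∀ (c : ℂ) x y, B (c • x) y = c * B x y)
    (hadd' : ∀ x y y', B x (y + y') = B x y + B x y')
    (hsmul' : ∀ (c : ℂ) x y, B x (c • y) = (starRingEnd ℂ) c * B x y)
    (C : ℝ) (hC : ∀ x y, ‖B x y‖ ≤ C * ‖x‖ * ‖y‖) :
    ∃ S : E →L[ℂ] E, ∀ x y, inner ℂ y (S x) = B x y := by
  let B' : E →ₗ⋆[ℂ] E →ₗ[ℂ] ℂ := LinearMap.mk₂'ₛₗ (starRingEnd ℂ) (RingHom.id ℂ) (fun y x => B x y)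
    (fun y y' x => hadd' x y y') (fun c y x => hsmul' c x y) (fun y x x' => hadd x x' y)
    (fun c y x => hsmul c x y)
  let B'' : E →L⋆[ℂ] E →L[ℂ] ℂ := LinearMap.mkContinuous₂ B' C fun y x => by
    rw [mul_right_comm]; exact hC x y
  refine ⟨(InnerProductSpace.continuousLinearMapOfBilin B'').adjoint, fun x y => ?_⟩
  rw [ContinuousLinearMap.adjoint_inner_right,
    InnerProductSpace.continuousLinearMapOfBilin_apply]
  rfl

/-- The bound is not homogeneous, so y is taken as S x rescaled to the length of x; this gives ‖x‖‖S
x‖ ≤ 2C‖x‖². -/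
theorem opNorm_le_of_dense_quadratic_bound (S : E →L[ℂ] E) {D : Set E} (hD : Dense D) {C : ℝ}
    (hC : 0 ≤ C) (h : ∀ x ∈ D, ∀ y ∈ D, ‖(inner ℂ y (S x) : ℂ)‖ ≤ C * (‖x‖ ^ 2 + ‖y‖ ^ 2)) :
    ‖S‖ ≤ 2 * C := by
  have key : ∀ p : E × E, ‖(inner ℂ p.2 (S p.1) : ℂ)‖ ≤ C * (‖p.1‖ ^ 2 + ‖p.2‖ ^ 2) := by
    refine (hD.prod hD).induction (fun p hp => h _ hp.1 _ hp.2) (isClosed_le ?_ ?_)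
    · exact (continuous_snd.inner (S.continuous.comp continuous_fst)).norm
    · fun_prop
  refine S.opNorm_le_bound (by positivity) fun x => ?_
  by_cases hx : S x = 0
  · rw [hx, norm_zero]; positivity
  by_cases hx0 : x = 0
  · simp [hx0]
  have hn : 0 < ‖S x‖ := norm_pos_iff.2 hx
  have hn0 : 0 < ‖x‖ := norm_pos_iff.2 hx0
  have := key (x, ((‖x‖ / ‖S x‖ : ℝ) : ℂ) • S x)
  simp only [inner_smul_left, Complex.conj_ofReal, inner_self_eq_norm_sq_to_K, norm_smul,
    norm_mul, norm_pow, Complex.norm_real, Real.norm_of_nonneg (div_nonneg hn0.le hn.le)] at this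
  rw [div_mul_cancel₀ _ hn.ne'] at this
  simp only [Complex.coe_algebraMap, Complex.norm_real, norm_norm] at this
  have h2 : ‖x‖ / ‖S x‖ * ‖S x‖ ^ 2 = ‖x‖ * ‖S x‖ := by field_simp
  rw [h2] at this
  nlinarith

end Hilbert

/-! ### Coefficients of the regular representation and the reduced C⋆-algebra -/

section Group

variable {G : Type*} [Group G] [TopologicalSpace G] [IsTopologicalGroup G] [LocallyCompactSpace G]
  [MeasurableSpace G] [BorelSpace G]

theorem norm_regularCoeff_le (ξ η : HaarL2 G) (s : G) : ‖regularCoeff ξ η s‖ ≤ ‖ξ‖ * ‖η‖ := by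
  unfold regularCoeff
  refine (norm_inner_le_norm _ _).trans ?_
  rw [LinearIsometry.norm_map, mul_comm]

theorem continuous_regularCoeff (ξ η : HaarL2 G) : Continuous (regularCoeff ξ η) := by
  have : Fact ((2 : ℝ≥0∞) ≠ ∞) := ⟨by simp⟩
  have h : ∀ s : G, leftRegular s ξ = DomMulAct.mk s⁻¹ • ξ := fun s => rfl
  unfold regularCoeff
  simp_rw [h]
  have h2 : Continuous fun s : G => DomMulAct.mk s⁻¹ • ξ :=
    (DomMulAct.continuous_mk.comp continuous_inv).smul continuous_const
  exact continuous_const.inner h2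

theorem regularCoeff_add_left (ξ ξ' η : HaarL2 G) (s : G) :
    regularCoeff (ξ + ξ') η s = regularCoeff ξ η s + regularCoeff ξ' η s := by
  simp [regularCoeff, inner_add_right]

theorem regularCoeff_smul_left (c : ℂ) (ξ η : HaarL2 G) (s : G) :
    regularCoeff (c • ξ) η s = c * regularCoeff ξ η s := by
  simp [regularCoeff, inner_smul_right]

theorem regularCoeff_add_right (ξ η η' : HaarL2 G) (s : G) :
    regularCoeff ξ (η + η') s = regularCoeff ξ η s + regularCoeff ξ η' s := by
  simp [regularCoeff, inner_add_left]

theorem regularCoeff_smul_right (c : ℂ) (ξ η : HaarL2 G) (s : G) :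
    regularCoeff ξ (c • η) s = (starRingEnd ℂ) c * regularCoeff ξ η s := by
  simp [regularCoeff, inner_smul_left]

theorem integrable_mul_regularCoeff {p : Measure G} {w : G → ℂ} (hw : Integrable w p)
    (ξ η : HaarL2 G) : Integrable (fun s => w s * regularCoeff ξ η s) p :=
  hw.mul_bdd (c := ‖ξ‖ * ‖η‖) (continuous_regularCoeff ξ η).measurable.aestronglyMeasurable
    (Filter.Eventually.of_forall fun s => norm_regularCoeff_le ξ η s)

/-- The operator `∫ w(s) λ_s dp(s)` as a weak integral. -/
theorem exists_clm_integral_mul_regularCoeff {p : Measure G} {w : G → ℂ} (hw : Integrable w p) :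
    ∃ S : HaarL2 G →L[ℂ] HaarL2 G, ∀ ξ η, inner ℂ η (S ξ) = ∫ s, w s * regularCoeff ξ η s ∂p := by
  refine exists_clm_inner_eq (fun ξ η => ∫ s, w s * regularCoeff ξ η s ∂p) ?_ ?_ ?_ ?_
    (∫ s, ‖w s‖ ∂p) ?_
  · intro x x' y
    simp_rw [regularCoeff_add_left, mul_add]
    exact integral_add (integrable_mul_regularCoeff hw _ _) (integrable_mul_regularCoeff hw _ _)
  · intro c x y
    simp_rw [regularCoeff_smul_left, mul_left_comm _ c]
    exact integral_const_mul _ _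
  · intro x y y'
    simp_rw [regularCoeff_add_right, mul_add]
    exact integral_add (integrable_mul_regularCoeff hw _ _) (integrable_mul_regularCoeff hw _ _)
  · intro c x y
    simp_rw [regularCoeff_smul_right, mul_left_comm _ ((starRingEnd ℂ) c)]
    exact integral_const_mul _ _
  · intro x y
    rw [mul_assoc, ← integral_mul_const]
    refine norm_integral_le_of_norm_le (hw.norm.mul_const _)
      (Filter.Eventually.of_forall fun s => ?_)
    rw [norm_mul]
    gcongr
    exact norm_regularCoeff_le x y s

theorem norm_le_of_inner_eq_integral {p : Measure G} {w : G → ℂ} (hw : Integrable w p)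
    {S : HaarL2 G →L[ℂ] HaarL2 G}
    (hS : ∀ ξ η, inner ℂ η (S ξ) = ∫ s, w s * regularCoeff ξ η s ∂p) :
    ‖S‖ ≤ ∫ s, ‖w s‖ ∂p := by
  refine S.opNorm_le_bound (by positivity) fun x => ?_
  have h : ‖(inner ℂ (S x) (S x) : ℂ)‖ ≤ (∫ s, ‖w s‖ ∂p) * (‖x‖ * ‖S x‖) := by
    rw [hS, ← integral_mul_const]
    refine norm_integral_le_of_norm_le (hw.norm.mul_const _)
      (Filter.Eventually.of_forall fun s => ?_)
    rw [norm_mul]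
    gcongr
    exact norm_regularCoeff_le x (S x) s
  rw [inner_self_eq_norm_sq_to_K, norm_pow] at h
  simp only [Complex.coe_algebraMap, Complex.norm_real, norm_norm] at h
  by_cases hx : S x = 0
  · rw [hx, norm_zero]; positivity
  have hn : 0 < ‖S x‖ := norm_pos_iff.2 hx
  nlinarith

theorem exists_isRegularOp_sum_scaledMeasure {ι : Type*} [Fintype ι]
    (p : ι → Measure G) [∀ k, IsFiniteMeasure (p k)] {c : ι → ℂ} (hc : ∀ k, ‖c k‖ ≤ 1) :
    ∃ S, IsRegularOp (∑ k, scaledMeasure (p k) (c k)) S := by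
  choose S hS using fun k => exists_clm_integral_mul_regularCoeff (p := p k)
    (w := fun _ => (1 : ℂ)) (integrable_const _)
  refine ⟨∑ k, c k • S k, fun ξ η => ?_⟩
  rw [cintegral_sum_scaledMeasure p hc fun k => by
    simpa using integrable_mul_regularCoeff (p := p k) (integrable_const (1 : ℂ)) ξ η]
  simp [inner_sum, inner_smul_right, hS]

/-- The coefficient `s ↦ ∫ f(s⁻¹ t) conj (g t) dt`. -/
noncomputable def ccoeff (f g : G → ℂ) (s : G) : ℂ :=
  ∫ t, f (s⁻¹ * t) * (starRingEnd ℂ) (g t) ∂(haar : Measure G)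

theorem IsCc.memLp {f : G → ℂ} (hf : IsCc f) : MemLp f 2 (haar : Measure G) :=
  hf.1.memLp_of_hasCompactSupport hf.2

/-- The class in `L²(G)` of a continuous function with compact support. -/
noncomputable def IsCc.toL2 {f : G → ℂ} (hf : IsCc f) : HaarL2 G := hf.memLp.toLp f

theorem IsCc.regularCoeff_toL2 {f g : G → ℂ} (hf : IsCc f) (hg : IsCc g) :
    regularCoeff hf.toL2 hg.toL2 = ccoeff f g := by
  ext s
  unfold regularCoeff ccoeff
  rw [L2.inner_def]
  have h1 : (leftRegular s hf.toL2 : G → ℂ) =ᵐ[haar] fun t => f (s⁻¹ * t) := by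
    refine (Lp.coeFn_compMeasurePreserving _ (measurePreserving_mul_left haar s⁻¹)).trans ?_
    exact (measurePreserving_mul_left haar s⁻¹).quasiMeasurePreserving.ae_eq_comp
      hf.memLp.coeFn_toLp
  refine integral_congr_ae ?_
  filter_upwards [h1, hg.memLp.coeFn_toLp] with t h1 h2
  rw [h1, IsCc.toL2, h2]
  simp

theorem IsCc.norm_toL2_sq {f : G → ℂ} (hf : IsCc f) :
    ‖hf.toL2‖ ^ 2 = ∫ t, ‖f t‖ ^ 2 ∂(haar : Measure G) := by
  have h := inner_self_eq_norm_sq_to_K (𝕜 := ℂ) hf.toL2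
  rw [L2.inner_def] at h
  have h2 : ∫ t, inner ℂ ((hf.toL2 : G → ℂ) t) ((hf.toL2 : G → ℂ) t) ∂(haar : Measure G) =
      ((∫ t, ‖f t‖ ^ 2 ∂(haar : Measure G) : ℝ) : ℂ) := by
    rw [← integral_complex_ofReal]
    refine integral_congr_ae ?_
    filter_upwards [hf.memLp.coeFn_toLp] with t h2
    rw [IsCc.toL2, h2, inner_self_eq_norm_sq_to_K]
    simp
  rw [h2] at h
  simp only [Complex.coe_algebraMap] at h
  exact_mod_cast h.symm

theorem dense_isCc_toL2 [T2Space G] : Dense {v : HaarL2 G | ∃ (f : G → ℂ) (hf : IsCc f), v = hf.toL2} := by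
  rw [Metric.dense_iff]
  intro ξ ε hε
  obtain ⟨g, hle, hg⟩ := exists_isCc_eLpNorm_sub_le
    (by simp) (Lp.memLp ξ) (ε := ENNReal.ofReal (ε / 2)) (by simpa using hε)
  refine ⟨hg.toL2, ?_, g, hg, rfl⟩
  rw [Metric.mem_ball, dist_comm, dist_eq_norm, Lp.norm_def]
  have h1 : eLpNorm (ξ - hg.toL2 : HaarL2 G) 2 haar = eLpNorm (⇑ξ - g) 2 haar := by
    refine eLpNorm_congr_ae ((Lp.coeFn_sub _ _).trans ?_)
    exact Filter.EventuallyEq.rfl.sub hg.memLp.coeFn_toLp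
  rw [h1]
  refine lt_of_le_of_lt (ENNReal.toReal_mono (by simp) hle) ?_
  rw [ENNReal.toReal_ofReal (by positivity)]
  linarith

/-- Since ‖λ(f)‖ ≤ ‖f‖₁, density of C_c in L¹ allows the approximant to be continuous with compact
support. -/
theorem exists_isCc_norm_sub_lt_of_mem_reducedCStar [T2Space G] {T : HaarL2 G →L[ℂ] HaarL2 G}
    (hT : T ∈ reducedCStar G) {ε : ℝ} (hε : 0 < ε) :
    ∃ (f : G → ℂ) (T' : HaarL2 G →L[ℂ] HaarL2 G), IsCc f ∧
      (∀ ξ η, inner ℂ η (T' ξ) = ∫ s, f s * regularCoeff ξ η s ∂(haar : Measure G)) ∧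
      ‖T - T'‖ < ε := by
  obtain ⟨T₁, ⟨f₁, hf₁, hT₁⟩, hlt⟩ := Metric.mem_closure_iff.1 hT (ε / 2) (by positivity)
  obtain ⟨f, hle, hf⟩ := exists_isCc_eLpNorm_sub_le (by simp) (memLp_one_iff_integrable.2 hf₁)
    (ε := ENNReal.ofReal (ε / 3)) (by simpa using hε)
  have hfi : Integrable f (haar : Measure G) := hf.integrable
  replace hle : ∫ s, ‖f₁ s - f s‖ ∂(haar : Measure G) ≤ ε / 3 := by
    refine (integral_norm_eq_lintegral_enorm (hf₁.sub hfi).aestronglyMeasurable).trans_le ?_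
    rw [eLpNorm_one_eq_lintegral_enorm] at hle
    exact ENNReal.toReal_le_of_le_ofReal (by positivity) hle
  obtain ⟨T', hT'⟩ := exists_clm_integral_mul_regularCoeff hfi
  refine ⟨f, T', hf, hT', ?_⟩
  have h : ‖T₁ - T'‖ ≤ ∫ s, ‖f₁ s - f s‖ ∂(haar : Measure G) := by
    refine norm_le_of_inner_eq_integral (hf₁.sub hfi) fun ξ η => ?_
    rw [_root_.sub_apply, inner_sub_right, hT₁, hT', ← integral_sub
      (integrable_mul_regularCoeff hf₁ _ _) (integrable_mul_regularCoeff hfi _ _)]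
    simp [sub_mul]
  rw [dist_eq_norm] at hlt
  calc ‖T - T'‖ = ‖(T - T₁) + (T₁ - T')‖ := by abel_nf
    _ ≤ ‖T - T₁‖ + ‖T₁ - T'‖ := norm_add_le _ _
    _ < ε := by linarith

-- A nonzero value confines s⁻¹t and t to compact sets, hence also s = t(s⁻¹t)⁻¹.
omit [LocallyCompactSpace G] [MeasurableSpace G] [BorelSpace G] in
theorem IsCc.ccoeff_uncurry [T2Space G] {f g : G → ℂ} (hf : IsCc f) (hg : IsCc g) :
    IsCc (Function.uncurry fun s t : G => f (s⁻¹ * t) * (starRingEnd ℂ) (g t)) := by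
  refine IsCc.of_forall_notMem (K := (fun p : G × G => (p.2 * p.1⁻¹, p.2)) ''
    (tsupport f ×ˢ tsupport g)) ?_ ((hf.2.isCompact.prod hg.2.isCompact).image (by fun_prop)) ?_
  · exact (hf.1.comp (by fun_prop)).mul (Complex.continuous_conj.comp (hg.1.comp continuous_snd))
  · rintro ⟨s, t⟩ h
    by_contra hne
    simp only [Function.uncurry_apply_pair, mul_eq_zero, not_or, map_eq_zero] at hne
    refine h ⟨(s⁻¹ * t, t), ⟨subset_tsupport _ hne.1, subset_tsupport _ hne.2⟩, ?_⟩
    simp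

theorem IsCc.ccoeff [T2Space G] {f g : G → ℂ} (hf : IsCc f) (hg : IsCc g) : IsCc (ccoeff f g) :=
  (hf.ccoeff_uncurry hg).integral_prod

end Group

/-! ### Averages over H and Weil's formula -/

section Quotient

variable {G : Type*} [Group G] [TopologicalSpace G] [IsTopologicalGroup G] [LocallyCompactSpace G]
  [T2Space G] [MeasurableSpace G] [BorelSpace G] (H : Subgroup G) (hH : IsClosed (H : Set G))

omit [T2Space G] in
theorem cosetAverage_mk (f : G → ℂ) (x : G) :
    cosetAverage H hH f (x : G ⧸ H) = ∫ h : H, f (x * h) ∂(subgroupHaar H hH) := rfl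

variable [H.Normal]

/-- The left average `H t ↦ ∫_H f(h⁻¹ t) dh`. -/
noncomputable def leftAverage (f : G → ℂ) (y : G ⧸ H) : ℂ :=
  cosetAverage H hH (fun t => f t⁻¹) y⁻¹

omit [T2Space G] in
theorem leftAverage_mk (f : G → ℂ) (x : G) :
    leftAverage H hH f (x : G ⧸ H) = ∫ h : H, f ((h : G)⁻¹ * x) ∂(subgroupHaar H hH) := by
  rw [leftAverage, ← QuotientGroup.mk_inv, cosetAverage_mk]
  simp

omit [T2Space G] in
theorem IsCc.cosetAverage {f : G → ℂ} (hf : IsCc f) : IsCc (cosetAverage H hH f) := by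
  have := subgroupHaar_isHaarMeasure H hH
  let F : CompactlySupportedContinuousMap G ℂ := ⟨⟨f, hf.1⟩, hf.2⟩
  have h : _root_.cosetAverage H hH f = (TopologicalGroup.IsSES.ofClosedSubgroup H hH).pushforward
      (subgroupHaar H hH) F := by
    ext x
    obtain ⟨x, rfl⟩ := QuotientGroup.mk_surjective x
    exact ((TopologicalGroup.IsSES.ofClosedSubgroup H hH).pushforward_apply_apply
      (subgroupHaar H hH) F x).symm
  rw [h]
  exact ⟨map_continuous _,
    CompactlySupportedContinuousMap.hasCompactSupport _⟩

omit [T2Space G] in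
theorem IsCc.leftAverage {f : G → ℂ} (hf : IsCc f) : IsCc (leftAverage H hH f) :=
  ((hf.comp_homeomorph (Homeomorph.inv G)).cosetAverage H hH).comp_homeomorph
    (Homeomorph.inv (G ⧸ H))

omit [T2Space G] [H.Normal] [LocallyCompactSpace G] [MeasurableSpace G] [BorelSpace G] in
include hH in
theorem isClosedEmbedding_mul_subgroup (x : G) : IsClosedEmbedding fun h : H => x * h :=
  (Homeomorph.mulLeft x).isClosedEmbedding.comp hH.isClosedEmbedding_subtypeVal

omit [T2Space G] [H.Normal] [LocallyCompactSpace G] [MeasurableSpace G] [BorelSpace G] in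
include hH in
theorem IsCc.comp_mul_left {f : G → ℂ} (hf : IsCc f) (x : G) : IsCc fun h : H => f (x * h) :=
  hf.comp_isClosedEmbedding (isClosedEmbedding_mul_subgroup H hH x)

omit [T2Space G] [H.Normal] in
theorem ofReal_cosetAverage (f : G → ℝ) (x : G ⧸ H) :
    ((cosetAverage H hH (fun y => (f y : ℂ)) x).re : ℂ) =
      cosetAverage H hH (fun y => (f y : ℂ)) x := by
  obtain ⟨x, rfl⟩ := QuotientGroup.mk_surjective x
  rw [cosetAverage_mk, integral_complex_ofReal, Complex.ofReal_re]

omit [T2Space G] [H.Normal] in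
theorem cosetAverage_mul_comp (f : G → ℂ) (g : G ⧸ H → ℂ) (x : G ⧸ H) :
    cosetAverage H hH (fun y => g y * f y) x = g x * cosetAverage H hH f x := by
  obtain ⟨x, rfl⟩ := QuotientGroup.mk_surjective x
  simp [cosetAverage_mk, integral_const_mul]

variable [MeasurableSpace (G ⧸ H)] [BorelSpace (G ⧸ H)]

/-- Weil's formula. -/
theorem exists_integral_eq_integral_cosetAverage : ∃ κ : ℝ, 0 < κ ∧ ∀ w : G → ℂ, IsCc w →
    ∫ t, w t ∂(haar : Measure G) = κ * ∫ y, cosetAverage H hH w y ∂(haar : Measure (G ⧸ H)) := by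
  have := subgroupHaar_isHaarMeasure H hH
  set S := TopologicalGroup.IsSES.ofClosedSubgroup H hH
  set m := S.inducedMeasure (subgroupHaar H hH) (haar : Measure (G ⧸ H))
  -- The constant κ compares the chosen Haar measure on G with the one induced from H and G/H.
  have hm : (haar : Measure G) = haarScalarFactor haar m • m :=
    isMulLeftInvariant_eq_smul_of_regular _ _
  refine ⟨haarScalarFactor haar m, haarScalarFactor_pos_of_isHaarMeasure _ _, fun w hw => ?_⟩
  have hreal : ∀ f : G → ℝ, Continuous f → HasCompactSupport f →
      ∫ t, (f t : ℂ) ∂m = ∫ y, cosetAverage H hH (fun t => (f t : ℂ)) y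
        ∂(haar : Measure (G ⧸ H)) := by
    intro f hf hfs
    rw [integral_complex_ofReal]
    refine (congrArg _ (S.integral_inducedMeasure (subgroupHaar H hH) haar ⟨⟨f, hf⟩, hfs⟩)).trans ?_
    rw [S.integrate_apply, ← integral_complex_ofReal]
    refine integral_congr_ae (Filter.Eventually.of_forall fun y => ?_)
    obtain ⟨x, rfl⟩ := QuotientGroup.mk_surjective y
    dsimp only
    rw [cosetAverage_mk, integral_complex_ofReal]
    exact congrArg _ (S.pushforward_apply_apply (subgroupHaar H hH) _ x)
  have hre := hreal (fun t => (w t).re) (Complex.continuous_re.comp hw.1)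
    (hw.2.comp_left (g := Complex.re) rfl)
  have him := hreal (fun t => (w t).im) (Complex.continuous_im.comp hw.1)
    (hw.2.comp_left (g := Complex.im) rfl)
  have hreC : IsCc fun t => ((w t).re : ℂ) :=
    ⟨by have := hw.1; fun_prop, hw.2.comp_left (g := fun z : ℂ => (z.re : ℂ)) (by simp)⟩
  have himC : IsCc fun t => ((w t).im : ℂ) :=
    ⟨by have := hw.1; fun_prop, hw.2.comp_left (g := fun z : ℂ => (z.im : ℂ)) (by simp)⟩
  have hsplit : ∀ t, w t = ((w t).re : ℂ) + Complex.I * ((w t).im : ℂ) := fun t => by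
    rw [mul_comm, Complex.re_add_im]
  conv_lhs => rw [hm, integral_smul_nnreal_measure]
  have h1 : ∫ t, w t ∂m = ∫ y, cosetAverage H hH w y ∂(haar : Measure (G ⧸ H)) := by
    calc ∫ t, w t ∂m = ∫ t, (((w t).re : ℂ) + Complex.I * ((w t).im : ℂ)) ∂m := by
          simp_rw [← hsplit]
      _ = ∫ y, (cosetAverage H hH (fun t => ((w t).re : ℂ)) y +
            Complex.I * cosetAverage H hH (fun t => ((w t).im : ℂ)) y)
            ∂(haar : Measure (G ⧸ H)) := by
          rw [integral_add hreC.integrable (himC.integrable.const_mul _),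
            integral_const_mul, hre, him, integral_add (hreC.cosetAverage H hH).integrable
            ((himC.cosetAverage H hH).integrable.const_mul _), integral_const_mul]
      _ = _ := by
          refine integral_congr_ae (Filter.Eventually.of_forall fun y => ?_)
          obtain ⟨x, rfl⟩ := QuotientGroup.mk_surjective y
          dsimp only
          rw [cosetAverage_mk, cosetAverage_mk, cosetAverage_mk, ← integral_const_mul,
            ← integral_add (hreC.comp_mul_left H hH x).integrable
              ((himC.comp_mul_left H hH x).integrable.const_mul _)]
          simp_rw [← hsplit]
  rw [h1]
  rfl

/-- By Fubini the average over H falls on a. The resulting factor depends only on the coset of x⁻¹t,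
so Weil's formula turns the integral over G into one over G/H and averages b. -/
theorem cosetAverage_ccoeff {κ : ℝ} (hκ : ∀ w : G → ℂ, IsCc w →
    ∫ t, w t ∂(haar : Measure G) = κ * ∫ y, cosetAverage H hH w y ∂(haar : Measure (G ⧸ H)))
    {a b : G → ℂ} (ha : IsCc a) (hb : IsCc b) (x : G ⧸ H) :
    cosetAverage H hH (ccoeff a b) x =
      κ * ccoeff (leftAverage H hH a) (cosetAverage H hH b) x := by
  have := subgroupHaar_isHaarMeasure H hH
  obtain ⟨x, rfl⟩ := QuotientGroup.mk_surjective x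
  have hF : IsCc (Function.uncurry fun (h : H) (t : G) =>
      a ((x * h)⁻¹ * t) * (starRingEnd ℂ) (b t)) := by
    have e : IsClosedEmbedding fun p : H × G => (x * (p.1 : G), p.2) :=
      (isClosedEmbedding_mul_subgroup H hH x).prodMap IsClosedEmbedding.id
    exact (ha.ccoeff_uncurry hb).comp_isClosedEmbedding e
  have hw : IsCc fun t => leftAverage H hH a ((x⁻¹ * t : G) : G ⧸ H) * (starRingEnd ℂ) (b t) :=
    hb.star.mul_left ((ha.leftAverage H hH).1.comp
      (QuotientGroup.continuous_mk.comp (continuous_const.mul continuous_id)))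
  calc cosetAverage H hH (ccoeff a b) x
      = ∫ t, ∫ h : H, a ((x * h)⁻¹ * t) * (starRingEnd ℂ) (b t) ∂(subgroupHaar H hH) ∂haar :=
        hF.integral_integral_swap
    _ = ∫ t, leftAverage H hH a ((x⁻¹ * t : G) : G ⧸ H) * (starRingEnd ℂ) (b t) ∂haar := by
        refine integral_congr_ae (Filter.Eventually.of_forall fun t => ?_)
        dsimp only
        rw [integral_mul_const, leftAverage_mk]
        simp [mul_assoc]
    _ = _ := by
        rw [hκ _ hw, ccoeff]
        congr 1
        refine integral_congr_ae (Filter.Eventually.of_forall fun y => ?_)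
        obtain ⟨y, rfl⟩ := QuotientGroup.mk_surjective y
        dsimp only
        rw [cosetAverage_mk, cosetAverage_mk, ← integral_conj, ← integral_const_mul]
        simp

end Quotient

/-! ### Cauchy–Schwarz and L²-bounds for averages -/

section CauchySchwarz

variable {X : Type*} [TopologicalSpace X] [MeasurableSpace X] [BorelSpace X]

theorem IsCc.norm_integral_mul_sq_le {μ : Measure X} [IsFiniteMeasureOnCompacts μ] {f g : X → ℂ}
    (hf : IsCc f) (hg : IsCc g) :
    ‖∫ x, f x * g x ∂μ‖ ^ 2 ≤ (∫ x, ‖f x‖ ^ 2 ∂μ) * ∫ x, ‖g x‖ ^ 2 ∂μ := by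
  have hmem : ∀ {u : X → ℂ}, IsCc u → MemLp (fun x => ‖u x‖) (ENNReal.ofReal 2) μ := fun hu => by
    have := (hu.1.memLp_of_hasCompactSupport (p := 2) (μ := μ) hu.2).norm
    simpa using this
  have h := integral_mul_le_Lp_mul_Lq_of_nonneg (μ := μ) Real.HolderConjugate.two_two
    (Filter.Eventually.of_forall fun x => norm_nonneg (f x))
    (Filter.Eventually.of_forall fun x => norm_nonneg (g x)) (hmem hf) (hmem hg)
  have h1 : ‖∫ x, f x * g x ∂μ‖ ≤ ∫ x, ‖f x‖ * ‖g x‖ ∂μ := by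
    refine (norm_integral_le_integral_norm _).trans_eq ?_
    simp
  have hA : 0 ≤ ∫ x, ‖f x‖ ^ 2 ∂μ := by positivity
  have hB : 0 ≤ ∫ x, ‖g x‖ ^ 2 ∂μ := by positivity
  simp only [Real.rpow_ofNat, ← Real.sqrt_eq_rpow] at h
  calc ‖∫ x, f x * g x ∂μ‖ ^ 2 ≤ (√(∫ x, ‖f x‖ ^ 2 ∂μ) * √(∫ x, ‖g x‖ ^ 2 ∂μ)) ^ 2 := by
        gcongr
        exact h1.trans h
    _ = _ := by rw [mul_pow, Real.sq_sqrt hA, Real.sq_sqrt hB]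

end CauchySchwarz

section Quotient

variable {G : Type*} [Group G] [TopologicalSpace G] [IsTopologicalGroup G] [LocallyCompactSpace G]
  (H : Subgroup G)

theorem exists_isCompact_subset_image_mk {K : Set (G ⧸ H)} (hK : IsCompact K) :
    ∃ K' : Set G, IsCompact K' ∧ K ⊆ (QuotientGroup.mk : G → G ⧸ H) '' K' := by
  refine hK.induction_on (p := fun K => ∃ K' : Set G, IsCompact K' ∧
    K ⊆ (QuotientGroup.mk : G → G ⧸ H) '' K') ⟨∅, isCompact_empty, by simp⟩ ?_ ?_ ?_
  · rintro s t hst ⟨K', hK', h⟩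
    exact ⟨K', hK', hst.trans h⟩
  · rintro s t ⟨K', hK', h⟩ ⟨L', hL', h'⟩
    exact ⟨K' ∪ L', hK'.union hL', by rw [Set.image_union]; exact Set.union_subset_union h h'⟩
  · intro x _
    obtain ⟨y, rfl⟩ := QuotientGroup.mk_surjective x
    obtain ⟨N, hN, hNy⟩ := exists_compact_mem_nhds y
    exact ⟨_, mem_nhdsWithin_of_mem_nhds (QuotientGroup.isOpenMap_coe.image_mem_nhds hNy),
      N, hN, subset_rfl⟩

variable [MeasurableSpace G] [BorelSpace G] [T2Space G] (hH : IsClosed (H : Set G)) [H.Normal]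

theorem isCc_ofReal {X : Type*} [TopologicalSpace X] {f : X → ℝ} (hf : Continuous f)
    (hs : HasCompactSupport f) : IsCc fun x => (f x : ℂ) :=
  ⟨Complex.continuous_ofReal.comp hf, hs.comp_left (g := fun r : ℝ => (r : ℂ)) rfl⟩

omit [T2Space G] [H.Normal] in
theorem cosetAverage_ofReal_mk (f : G → ℝ) (x : G) :
    cosetAverage H hH (fun t => (f t : ℂ)) (x : G ⧸ H) =
      ((∫ h : H, f (x * h) ∂(subgroupHaar H hH) : ℝ) : ℂ) := by
  rw [cosetAverage_mk, integral_complex_ofReal]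

-- Surjectivity of φ on nonnegative functions: take f = (g / φ(χ)) ∘ q · χ, with χ a bump equal to 1
-- on a compact set whose image covers the support of g.
omit [T2Space G] in
theorem exists_cosetAverage_eq {g : G ⧸ H → ℝ} (hg : Continuous g) (hgs : HasCompactSupport g)
    (hg0 : ∀ y, 0 ≤ g y) : ∃ f : G → ℝ, Continuous f ∧ HasCompactSupport f ∧ (∀ x, 0 ≤ f x) ∧
      ∀ y, cosetAverage H hH (fun t => (f t : ℂ)) y = g y := by
  have := subgroupHaar_isHaarMeasure H hH
  obtain ⟨K', hK', hsub⟩ := exists_isCompact_subset_image_mk H hgs.isCompact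
  obtain ⟨χ, hχ1, hχs, -, hχ01⟩ := exists_continuousMap_one_of_isCompact_subset_isOpen hK'
    isOpen_univ (Set.subset_univ _)
  have hχ := isCc_ofReal χ.continuous hχs
  set d : G ⧸ H → ℝ := fun y => (cosetAverage H hH (fun t => (χ t : ℂ)) y).re
  have hd : Continuous d := Complex.continuous_re.comp (hχ.cosetAverage H hH).1
  have hdpos : ∀ y ∈ tsupport g, 0 < d y := by
    intro y hy
    obtain ⟨x, hx, rfl⟩ := hsub hy
    simp only [d]
    rw [cosetAverage_ofReal_mk, Complex.ofReal_re]
    have e := isClosedEmbedding_mul_subgroup H hH x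
    refine Continuous.integral_pos_of_hasCompactSupport_nonneg_nonzero (x := (1 : H))
      (χ.continuous.comp e.continuous) (HasCompactSupport.comp_isClosedEmbedding hχs e) (fun h => (hχ01 _).1) ?_
    have h1 : χ x = 1 := hχ1 hx
    simp [h1]
  obtain ⟨m, hm, hmd⟩ : ∃ m : ℝ, 0 < m ∧ ∀ y ∈ tsupport g, m ≤ d y := by
    rcases (tsupport g).eq_empty_or_nonempty with h | h
    · exact ⟨1, one_pos, by simp [h]⟩
    · obtain ⟨y, hy, hmin⟩ := hgs.isCompact.exists_isMinOn h hd.continuousOn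
      exact ⟨d y, hdpos y hy, fun z hz => hmin hz⟩
  -- The maximum with m keeps the denominator away from zero and changes nothing on the support of
  -- g.
  set r : G ⧸ H → ℝ := fun y => g y / max (d y) m
  have hr : Continuous r := hg.div (hd.max continuous_const) fun y => (lt_max_of_lt_right hm).ne'
  refine ⟨fun x => r x * χ x, ?_, HasCompactSupport.mul_left hχs, ?_, fun y => ?_⟩
  · exact (hr.comp QuotientGroup.continuous_mk).mul χ.continuous
  · exact fun x => mul_nonneg (div_nonneg (hg0 _) (hm.le.trans (le_max_right _ _))) (hχ01 x).1
  · have h := cosetAverage_mul_comp H hH (fun t => (χ t : ℂ)) (fun y => (r y : ℂ)) y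
    simp only [Complex.ofReal_mul]
    rw [h, ← ofReal_cosetAverage, ← Complex.ofReal_mul]
    congr 1
    change g y / max (d y) m * d y = g y
    by_cases hy : y ∈ tsupport g
    · rw [max_eq_left (hmd y hy), div_mul_cancel₀ _ (hdpos y hy).ne']
    · simp [image_eq_zero_of_notMem_tsupport hy]

-- Cauchy–Schwarz on each coset against a bump χ equal to 1 on K; the constant bounds φ(χ²) and does
-- not depend on b.
omit [T2Space G] in
theorem exists_norm_cosetAverage_sq_le {K : Set G} (hK : IsCompact K) :
    ∃ C : ℝ, 0 ≤ C ∧ ∀ b : G → ℂ, IsCc b → (∀ t, t ∉ K → b t = 0) → ∀ y,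
      ‖cosetAverage H hH b y‖ ^ 2 ≤
        C * (cosetAverage H hH (fun t => ((‖b t‖ ^ 2 : ℝ) : ℂ)) y).re := by
  have := subgroupHaar_isHaarMeasure H hH
  obtain ⟨χ, hχ1, hχs, -, hχ01⟩ := exists_continuousMap_one_of_isCompact_subset_isOpen hK
    isOpen_univ (Set.subset_univ _)
  have hχ := isCc_ofReal χ.continuous hχs
  obtain ⟨C, hC⟩ := (hχ.normSq.cosetAverage H hH).exists_bound
  have hC0 : 0 ≤ C := (norm_nonneg _).trans (hC 1)
  refine ⟨C, hC0, fun b hb hbK y => ?_⟩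
  have hCy := hC y
  obtain ⟨x, rfl⟩ := QuotientGroup.mk_surjective y
  have h1 : cosetAverage H hH b x = ∫ h : H, b (x * h) * χ (x * h) ∂(subgroupHaar H hH) := by
    rw [cosetAverage_mk]
    refine integral_congr_ae (Filter.Eventually.of_forall fun h => ?_)
    dsimp only
    by_cases hh : x * (h : G) ∈ K
    · have : χ (x * h) = 1 := hχ1 hh
      simp [this]
    · simp [hbK _ hh]
  rw [h1]
  refine ((hb.comp_mul_left H hH x).norm_integral_mul_sq_le (hχ.comp_mul_left H hH x)).trans ?_
  rw [cosetAverage_ofReal_mk] at hCy ⊢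
  rw [Complex.ofReal_re, mul_comm]
  gcongr
  exact (le_abs_self _).trans (by simpa using hCy)

variable [MeasurableSpace (G ⧸ H)] [BorelSpace (G ⧸ H)]

theorem exists_norm_toL2_cosetAverage_sq_le {K : Set G} (hK : IsCompact K) :
    ∃ C : ℝ, 0 ≤ C ∧ ∀ (b : G → ℂ) (hb : IsCc b), (∀ t, t ∉ K → b t = 0) →
      ‖(hb.cosetAverage H hH).toL2‖ ^ 2 ≤ C * ∫ t, ‖b t‖ ^ 2 ∂(haar : Measure G) := by
  obtain ⟨C, hC, h⟩ := exists_norm_cosetAverage_sq_le H hH hK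
  obtain ⟨κ, hκ0, hκ⟩ := exists_integral_eq_integral_cosetAverage H hH
  refine ⟨C * κ⁻¹, by positivity, fun b hb hbK => ?_⟩
  have hw := hκ _ hb.normSq
  rw [integral_complex_ofReal] at hw
  have hw2 : ∫ t, ‖b t‖ ^ 2 ∂(haar : Measure G) = κ * ∫ y,
      (cosetAverage H hH (fun t => ((‖b t‖ ^ 2 : ℝ) : ℂ)) y).re ∂(haar : Measure (G ⧸ H)) := by
    rw [← Complex.ofReal_inj, hw, Complex.ofReal_mul, ← integral_complex_ofReal]
    simp_rw [ofReal_cosetAverage]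
  rw [IsCc.norm_toL2_sq, hw2, mul_assoc, inv_mul_cancel_left₀ hκ0.ne', ← integral_const_mul]
  refine integral_mono ?_ ?_ (h b hb hbK)
  · have := (hb.cosetAverage H hH).normSq.integrable (μ := haar)
    exact this.re
  · exact ((hb.normSq.cosetAverage H hH).integrable (μ := haar)).re.const_mul C

/-- Weil's formula concerns the other average, so the left average is weighted by some f with φ(f) =
1 on the image of K. Unfolding gives ∫ a(t) ∫_H f(ht) dh dt, whose inner integral is bounded for t ∈
K. -/
theorem exists_integral_leftAverage_le {K : Set G} (hK : IsCompact K) :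
    ∃ C : ℝ, 0 ≤ C ∧ ∀ a : G → ℂ, IsCc a → (∀ t, t ∉ K → a t = 0) →
      ‖∫ y, leftAverage H hH a y ∂(haar : Measure (G ⧸ H))‖ ≤
        C * ∫ t, ‖a t‖ ∂(haar : Measure G) := by
  have := subgroupHaar_isHaarMeasure H hH
  have : IsClosed (H : Set G) := hH
  obtain ⟨κ, hκ0, hκ⟩ := exists_integral_eq_integral_cosetAverage H hH
  obtain ⟨g, hg1, hgs, -, hg01⟩ := exists_continuousMap_one_of_isCompact_subset_isOpen
    (hK.image (QuotientGroup.continuous_mk (N := H))) isOpen_univ (Set.subset_univ _)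
  obtain ⟨f, hf, hfs, -, hfg⟩ := exists_cosetAverage_eq H hH g.continuous hgs fun y => (hg01 y).1
  have hfC := isCc_ofReal hf hfs
  obtain ⟨χ, hχ1, hχs, -, hχ01⟩ := exists_continuousMap_one_of_isCompact_subset_isOpen hK
    isOpen_univ (Set.subset_univ _)
  have hχ := isCc_ofReal χ.continuous hχs
  have hS : ∀ {a : G → ℂ}, IsCc a → IsCc (Function.uncurry fun (t : G) (h : H) =>
      f (h * t) * (starRingEnd ℂ) (a t)) := fun ha => by
    have e : IsClosedEmbedding fun p : G × H => ((p.2 : G)⁻¹, p.1) :=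
      (((Homeomorph.inv G).isClosedEmbedding.comp hH.isClosedEmbedding_subtypeVal).prodMap
        IsClosedEmbedding.id).comp (Homeomorph.prodComm G H).isClosedEmbedding
    simpa [Function.uncurry_def] using (hfC.ccoeff_uncurry ha).comp_isClosedEmbedding e
  obtain ⟨D, hD⟩ := ((hS hχ).integral_prod (μ := subgroupHaar H hH)).exists_bound
  have hD0 : 0 ≤ D := (norm_nonneg _).trans (hD 1)
  refine ⟨κ⁻¹ * D, by positivity, fun a ha haK => ?_⟩
  have h1 : ∀ y, leftAverage H hH a y =
      cosetAverage H hH (fun t => leftAverage H hH a t * (f t : ℂ)) y := by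
    intro y
    rw [cosetAverage_mul_comp, hfg]
    by_cases hy : y ∈ (QuotientGroup.mk : G → G ⧸ H) '' K
    · have : g y = 1 := hg1 hy
      simp [this]
    · obtain ⟨x, rfl⟩ := QuotientGroup.mk_surjective y
      have : leftAverage H hH a (x : G ⧸ H) = 0 := by
        rw [leftAverage_mk]
        refine integral_eq_zero_of_ae (Filter.Eventually.of_forall fun h => haK _ fun hh => hy ?_)
        refine ⟨_, hh, ?_⟩
        have : ((h : G) : G ⧸ H) = 1 := (QuotientGroup.eq_one_iff _).2 h.2
        simp [this]
      rw [this, zero_mul]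
  have hw : IsCc fun t : G => leftAverage H hH a t * (f t : ℂ) :=
    hfC.mul_left ((ha.leftAverage H hH).1.comp QuotientGroup.continuous_mk)
  have hF : IsCc (Function.uncurry fun (t : G) (h : H) => a ((h : G)⁻¹ * t) * (f t : ℂ)) := by
    have e : IsClosedEmbedding fun p : G × H => ((p.2 : G), p.1) :=
      (hH.isClosedEmbedding_subtypeVal.prodMap
        IsClosedEmbedding.id).comp (Homeomorph.prodComm G H).isClosedEmbedding
    simpa [Function.uncurry_def] using (ha.ccoeff_uncurry hfC).comp_isClosedEmbedding e
  have h2 : κ * ∫ y, leftAverage H hH a y ∂(haar : Measure (G ⧸ H)) =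
      ∫ t, a t * ∫ h : H, (f (h * t) : ℂ) ∂(subgroupHaar H hH) ∂(haar : Measure G) := by
    rw [integral_congr_ae (Filter.Eventually.of_forall h1), ← hκ _ hw]
    calc ∫ t, leftAverage H hH a t * (f t : ℂ) ∂(haar : Measure G)
        = ∫ t, ∫ h : H, a ((h : G)⁻¹ * t) * (f t : ℂ) ∂(subgroupHaar H hH) ∂(haar : Measure G) := by
          simp_rw [leftAverage_mk, integral_mul_const]
      _ = ∫ h : H, ∫ t, a ((h : G)⁻¹ * t) * (f t : ℂ) ∂(haar : Measure G) ∂(subgroupHaar H hH) :=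
          hF.integral_integral_swap
      _ = ∫ h : H, ∫ t, a t * (f (h * t) : ℂ) ∂(haar : Measure G) ∂(subgroupHaar H hH) := by
          refine integral_congr_ae (Filter.Eventually.of_forall fun h => ?_)
          dsimp only
          rw [← integral_mul_left_eq_self _ (h : G)]
          simp
      _ = ∫ t, ∫ h : H, a t * (f (h * t) : ℂ) ∂(subgroupHaar H hH) ∂(haar : Measure G) := by
          refine (IsCc.integral_integral_swap ?_).symm
          have := hS ha.star
          simpa [mul_comm] using this
      _ = _ := by simp_rw [integral_const_mul]
  have h3 : ‖∫ t, a t * ∫ h : H, (f (h * t) : ℂ) ∂(subgroupHaar H hH) ∂(haar : Measure G)‖ ≤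
      D * ∫ t, ‖a t‖ ∂(haar : Measure G) := by
    rw [← integral_const_mul]
    refine norm_integral_le_of_norm_le (ha.integrable.norm.const_mul _)
      (Filter.Eventually.of_forall fun t => ?_)
    by_cases ht : t ∈ K
    · have := hD t
      have h1 : χ t = 1 := hχ1 ht
      simp only [h1, Complex.ofReal_one, map_one, mul_one] at this
      rw [norm_mul, mul_comm]
      gcongr
    · simp [haK t ht]
  rw [← h2, norm_mul, Complex.norm_real, Real.norm_of_nonneg hκ0.le] at h3
  rwa [mul_assoc, ← div_eq_inv_mul, le_div_iff₀' hκ0]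

/-- The pointwise bound is applied to t ↦ a(t⁻¹), supported in K⁻¹; the integral bound is then
applied to |a|². -/
theorem exists_norm_toL2_leftAverage_sq_le {K : Set G} (hK : IsCompact K) :
    ∃ C : ℝ, 0 ≤ C ∧ ∀ (a : G → ℂ) (ha : IsCc a), (∀ t, t ∉ K → a t = 0) →
      ‖(ha.leftAverage H hH).toL2‖ ^ 2 ≤ C * ∫ t, ‖a t‖ ^ 2 ∂(haar : Measure G) := by
  obtain ⟨C, hC, h⟩ := exists_norm_cosetAverage_sq_le H hH hK.inv
  obtain ⟨D, hD, h'⟩ := exists_integral_leftAverage_le H hH hK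
  refine ⟨C * D, by positivity, fun a ha haK => ?_⟩
  have h1 : ∀ y, ‖leftAverage H hH a y‖ ^ 2 ≤
      C * (leftAverage H hH (fun t => ((‖a t‖ ^ 2 : ℝ) : ℂ)) y).re := fun y =>
    h _ (ha.comp_homeomorph (Homeomorph.inv G)) (fun t ht => haK _ (by simpa using ht)) y⁻¹
  have h2 := h' _ ha.normSq fun t ht => by simp [haK t ht]
  have hint := (ha.normSq.leftAverage H hH).integrable (μ := haar)
  rw [IsCc.norm_toL2_sq, mul_assoc]
  calc ∫ y, ‖leftAverage H hH a y‖ ^ 2 ∂(haar : Measure (G ⧸ H))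
      ≤ ∫ y, C * (leftAverage H hH (fun t => ((‖a t‖ ^ 2 : ℝ) : ℂ)) y).re
          ∂(haar : Measure (G ⧸ H)) :=
        integral_mono (ha.leftAverage H hH).normSq.integrable.re (hint.re.const_mul C) h1
    _ = C * (∫ y, leftAverage H hH (fun t => ((‖a t‖ ^ 2 : ℝ) : ℂ)) y
          ∂(haar : Measure (G ⧸ H))).re := by
        rw [integral_const_mul]
        congr 1
        exact integral_re hint
    _ ≤ C * (D * ∫ t, ‖a t‖ ^ 2 ∂(haar : Measure G)) := by
        gcongr
        refine (Complex.re_le_norm _).trans (h2.trans_eq ?_)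
        simp

end Quotient

/-! ### Lifting measures from G/H to G by Riesz representation -/

section Riesz

variable {X : Type*} [TopologicalSpace X] [T2Space X] [LocallyCompactSpace X] [MeasurableSpace X]
  [BorelSpace X]

theorem measure_eq_zero_of_forall_integral_eq_zero {m : Measure X} [m.Regular] {U : Set X}
    (hU : IsOpen U) (h : ∀ f : X → ℝ, Continuous f → HasCompactSupport f → tsupport f ⊆ U →
      ∫ x, f x ∂m = 0) : m U = 0 := by
  by_contra hne
  obtain ⟨K, hKU, hK, hpos⟩ := Regular.innerRegular hU 0 (pos_iff_ne_zero.2 hne)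
  obtain ⟨χ, hχ1, hχs, hχU, hχ01⟩ := exists_continuousMap_one_of_isCompact_subset_isOpen hK hU hKU
  have h1 : ∫ x, K.indicator (fun _ => (1 : ℝ)) x ∂m ≤ ∫ x, χ x ∂m := by
    refine integral_mono ?_ (χ.continuous.integrable_of_hasCompactSupport hχs) fun x => ?_
    · exact (integrable_indicator_iff hK.measurableSet).2
        (integrableOn_const hK.measure_lt_top.ne)
    · by_cases hx : x ∈ K
      · simp [hx, hχ1 hx]
      · simpa [hx] using (hχ01 x).1
  rw [h χ χ.continuous hχs hχU, integral_indicator_const _ hK.measurableSet, smul_eq_mul,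
    mul_one] at h1
  exact (ENNReal.toReal_pos hpos.ne' hK.measure_lt_top.ne).not_ge h1

end Riesz

section Quotient

variable {G : Type*} [Group G] [TopologicalSpace G] [IsTopologicalGroup G] [LocallyCompactSpace G]
  [MeasurableSpace G] [BorelSpace G] [T2Space G] (H : Subgroup G) (hH : IsClosed (H : Set G))
  [H.Normal]

omit [T2Space G] [H.Normal] in
theorem cosetAverage_add {f g : G → ℂ} (hf : IsCc f) (hg : IsCc g) (y : G ⧸ H) :
    cosetAverage H hH (fun t => f t + g t) y = cosetAverage H hH f y + cosetAverage H hH g y := by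
  have := subgroupHaar_isHaarMeasure H hH
  obtain ⟨x, rfl⟩ := QuotientGroup.mk_surjective y
  exact integral_add (hf.comp_mul_left H hH x).integrable (hg.comp_mul_left H hH x).integrable

omit [T2Space G] [H.Normal] in
theorem cosetAverage_const_mul (c : ℂ) (f : G → ℂ) (y : G ⧸ H) :
    cosetAverage H hH (fun t => c * f t) y = c * cosetAverage H hH f y :=
  cosetAverage_mul_comp H hH f (fun _ => c) y

variable [MeasurableSpace (G ⧸ H)] [BorelSpace (G ⧸ H)]

/-- Since ρ ≥ 0 the functional f ↦ ∫ φ(ρf) dp is positive. The case ρ = 1 is needed too; the measure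
is then only known to be finite on compact sets. -/
theorem exists_measure_integral_eq_integral_cosetAverage (p : Measure (G ⧸ H)) [IsFiniteMeasure p]
    {ρ : G → ℝ} (hρ : Continuous ρ) (hρ0 : ∀ x, 0 ≤ ρ x) :
    ∃ m : Measure G, m.Regular ∧ ∀ w : G → ℂ, IsCc w →
      ∫ x, w x ∂m = ∫ y, cosetAverage H hH (fun x => ρ x * w x) y ∂p := by
  have := subgroupHaar_isHaarMeasure H hH
  have hC : ∀ f : CompactlySupportedContinuousMap G ℝ, IsCc fun x => (ρ x : ℂ) * (f x : ℂ) :=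
    fun f => (isCc_ofReal f.continuous f.hasCompactSupport).mul_left
      (Complex.continuous_ofReal.comp hρ)
  have hI : ∀ f : CompactlySupportedContinuousMap G ℝ,
      Integrable (cosetAverage H hH fun x => (ρ x : ℂ) * (f x : ℂ)) p :=
    fun f => ((hC f).cosetAverage H hH).integrable
  let Λ : CompactlySupportedContinuousMap G ℝ →ₗ[ℝ] ℝ :=
    { toFun := fun f => (∫ y, cosetAverage H hH (fun x => (ρ x : ℂ) * (f x : ℂ)) y ∂p).re
      map_add' := fun f g => by
        rw [← Complex.add_re, ← integral_add (hI f) (hI g)]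
        simp_rw [← cosetAverage_add H hH (hC f) (hC g), ← mul_add]
        simp
      map_smul' := fun c f => by
        have h : ∀ y, cosetAverage H hH (fun x => (ρ x : ℂ) * ((c • f) x : ℂ)) y =
            c * cosetAverage H hH (fun x => (ρ x : ℂ) * (f x : ℂ)) y := fun y => by
          rw [← cosetAverage_const_mul]
          congr 1
          ext x
          simp
          ring
        simp_rw [h, integral_const_mul]
        simp }
  have hmono : Monotone Λ := by
    intro f g hfg
    have h1 : ∀ u : CompactlySupportedContinuousMap G ℝ, Λ u =
        ∫ y, (cosetAverage H hH (fun x => (ρ x : ℂ) * (u x : ℂ)) y).re ∂p := fun u =>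
      (integral_re (hI u)).symm
    rw [h1, h1]
    refine integral_mono (hI f).re (hI g).re fun y => ?_
    obtain ⟨x, rfl⟩ := QuotientGroup.mk_surjective y
    dsimp only
    simp_rw [← Complex.ofReal_mul]
    rw [cosetAverage_ofReal_mk, cosetAverage_ofReal_mk, Complex.ofReal_re, Complex.ofReal_re]
    have hint : ∀ u : CompactlySupportedContinuousMap G ℝ,
        Integrable (fun h : H => ρ (x * h) * u (x * h)) (subgroupHaar H hH) := fun u => by
      have := ((hC u).comp_mul_left H hH x).integrable (μ := subgroupHaar H hH)
      simpa using this.re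
    exact integral_mono (hint f) (hint g) fun h => mul_le_mul_of_nonneg_left (hfg _) (hρ0 _)
  refine ⟨RealRMK.rieszMeasure ⟨Λ, hmono⟩, RealRMK.regular_rieszMeasure _, fun w hw => ?_⟩
  set m := RealRMK.rieszMeasure ⟨Λ, hmono⟩
  have hreal : ∀ f : G → ℝ, Continuous f → HasCompactSupport f →
      ∫ x, (f x : ℂ) ∂m = ∫ y, cosetAverage H hH (fun x => (ρ x : ℂ) * (f x : ℂ)) y ∂p := by
    intro f hf hfs
    rw [integral_complex_ofReal]
    refine (congrArg _ (RealRMK.integral_rieszMeasure ⟨Λ, hmono⟩ ⟨⟨f, hf⟩, hfs⟩)).trans ?_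
    change (((∫ y, cosetAverage H hH (fun x => (ρ x : ℂ) * (f x : ℂ)) y ∂p).re : ℝ) : ℂ) = _
    have h2 : ∫ y, cosetAverage H hH (fun x => (ρ x : ℂ) * (f x : ℂ)) y ∂p =
        ((∫ y, (cosetAverage H hH (fun x => (ρ x : ℂ) * (f x : ℂ)) y).re ∂p : ℝ) : ℂ) := by
      rw [← integral_complex_ofReal]
      simp_rw [← Complex.ofReal_mul, ofReal_cosetAverage]
    rw [h2, Complex.ofReal_re]
  have hre := hreal (fun t => (w t).re) (Complex.continuous_re.comp hw.1)
    (hw.2.comp_left (g := Complex.re) rfl)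
  have him := hreal (fun t => (w t).im) (Complex.continuous_im.comp hw.1)
    (hw.2.comp_left (g := Complex.im) rfl)
  have hreC : IsCc fun t => ((w t).re : ℂ) :=
    ⟨by have := hw.1; fun_prop, hw.2.comp_left (g := fun z : ℂ => (z.re : ℂ)) (by simp)⟩
  have himC : IsCc fun t => ((w t).im : ℂ) :=
    ⟨by have := hw.1; fun_prop, hw.2.comp_left (g := fun z : ℂ => (z.im : ℂ)) (by simp)⟩
  have hsplit : ∀ t, w t = ((w t).re : ℂ) + Complex.I * ((w t).im : ℂ) := fun t => by
    rw [mul_comm, Complex.re_add_im]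
  have hρC : Continuous fun x => (ρ x : ℂ) := Complex.continuous_ofReal.comp hρ
  have hreR := hreC.mul_left hρC
  have himR := himC.mul_left hρC
  calc ∫ t, w t ∂m = ∫ t, (((w t).re : ℂ) + Complex.I * ((w t).im : ℂ)) ∂m := by
        simp_rw [← hsplit]
    _ = ∫ y, (cosetAverage H hH (fun t => ρ t * ((w t).re : ℂ)) y +
          Complex.I * cosetAverage H hH (fun t => ρ t * ((w t).im : ℂ)) y) ∂p := by
        rw [integral_add hreC.integrable (himC.integrable.const_mul _),
          integral_const_mul, hre, him, integral_add (hreR.cosetAverage H hH).integrable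
          ((himR.cosetAverage H hH).integrable.const_mul _), integral_const_mul]
    _ = _ := by
        refine integral_congr_ae (Filter.Eventually.of_forall fun y => ?_)
        dsimp only
        rw [← cosetAverage_const_mul, ← cosetAverage_add H hH hreR (himR.mul_left continuous_const)]
        congr 1
        ext t
        conv_rhs => rw [hsplit t]
        ring

/-- The measure vanishes off the support of ρ: hence it is finite, and a cutoff equal to 1 there
extends the formula to all continuous u. -/
theorem exists_finite_measure_integral_eq_integral_cosetAverage (p : Measure (G ⧸ H))
    [IsFiniteMeasure p] {ρ : G → ℝ} (hρ : Continuous ρ) (hρs : HasCompactSupport ρ)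
    (hρ0 : ∀ x, 0 ≤ ρ x) :
    ∃ m : Measure G, m.Regular ∧ IsFiniteMeasure m ∧
      (∀ U : Set (G ⧸ H), IsOpen U → p U = 0 → m ((QuotientGroup.mk : G → G ⧸ H) ⁻¹' U) = 0) ∧
      ∀ u : G → ℂ, Continuous u →
        ∫ x, u x ∂m = ∫ y, cosetAverage H hH (fun x => ρ x * u x) y ∂p := by
  obtain ⟨m, hm, hmw⟩ := exists_measure_integral_eq_integral_cosetAverage H hH p hρ hρ0
  have hcast : ∀ f : G → ℝ, Continuous f → HasCompactSupport f →
      ∫ y, cosetAverage H hH (fun x => ρ x * (f x : ℂ)) y ∂p = 0 → ∫ x, f x ∂m = 0 := by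
    intro f hf hfs h0
    rw [← Complex.ofReal_inj, ← integral_complex_ofReal, hmw _ (isCc_ofReal hf hfs), h0,
      Complex.ofReal_zero]
  have hnull : m (tsupport ρ)ᶜ = 0 := by
    refine measure_eq_zero_of_forall_integral_eq_zero (isClosed_tsupport ρ).isOpen_compl
      fun f hf hfs hfU => hcast f hf hfs ?_
    -- The zero function is written as a product so that `cosetAverage_const_mul` can pull out a
    -- factor 0.
    have h0 : (fun x => (ρ x : ℂ) * (f x : ℂ)) = fun _ => 0 * 0 := by
      ext x
      by_cases hx : x ∈ tsupport ρ
      · simp [image_eq_zero_of_notMem_tsupport fun h => hfU h hx]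
      · simp [image_eq_zero_of_notMem_tsupport hx]
    rw [h0]
    simp_rw [cosetAverage_const_mul]
    simp
  refine ⟨m, hm, ⟨?_⟩, fun U hU hp => ?_, fun u hu => ?_⟩
  · rw [← Set.union_compl_self (tsupport ρ)]
    refine (measure_union_le _ _).trans_lt ?_
    rw [hnull, add_zero]
    exact hρs.isCompact.measure_lt_top
  · refine measure_eq_zero_of_forall_integral_eq_zero (hU.preimage QuotientGroup.continuous_mk)
      fun f hf hfs hfU => hcast f hf hfs ?_
    refine integral_eq_zero_of_ae ?_
    have : ∀ᵐ y ∂p, y ∉ U := measure_eq_zero_iff_ae_notMem.1 hp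
    filter_upwards [this] with y hy
    obtain ⟨x, rfl⟩ := QuotientGroup.mk_surjective y
    rw [cosetAverage_mk]
    refine integral_eq_zero_of_ae (Filter.Eventually.of_forall fun h => ?_)
    have : f (x * h) = 0 := image_eq_zero_of_notMem_tsupport fun hh => hy (by simpa using hfU hh)
    simp [this]
  · obtain ⟨χ, hχ1, hχs, -, -⟩ := exists_continuousMap_one_of_isCompact_subset_isOpen
      hρs.isCompact isOpen_univ (Set.subset_univ _)
    have hw : IsCc fun x => (χ x : ℂ) * u x := (isCc_ofReal χ.continuous hχs).mul_right hu
    have h1 : ∫ x, u x ∂m = ∫ x, (χ x : ℂ) * u x ∂m := by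
      refine integral_congr_ae ?_
      filter_upwards [measure_eq_zero_iff_ae_notMem.1 hnull] with x hx
      have : χ x = 1 := hχ1 (by simpa using hx)
      simp [this]
    rw [h1, hmw _ hw]
    refine integral_congr_ae (Filter.Eventually.of_forall fun y => ?_)
    congr 1
    ext x
    by_cases hx : x ∈ tsupport ρ
    · have : χ x = 1 := hχ1 hx
      simp [this]
    · simp [image_eq_zero_of_notMem_tsupport hx]

end Quotient

/-! ### Absorption and the norm estimate for the transport -/

section Tensor

variable {G : Type*} [Group G] [TopologicalSpace G] [IsTopologicalGroup G] [LocallyCompactSpace G]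
  [MeasurableSpace G] [BorelSpace G] [T2Space G]

omit [LocallyCompactSpace G] [MeasurableSpace G] [BorelSpace G] [T2Space G] in
theorem IsCc.mul_translate {ξ : G → ℂ} (hξ : IsCc ξ) {f : G → ℂ} (hf : IsCc f) (r : G) :
    IsCc fun t => ξ t * f (t * r) :=
  hξ.mul_right (hf.1.comp (continuous_mul_const r))

omit [LocallyCompactSpace G] [MeasurableSpace G] [BorelSpace G] [T2Space G] in
theorem IsCc.mul_translate_uncurry {ξ f : G → ℂ} (hξ : IsCc ξ) (hf : IsCc f) :
    IsCc (Function.uncurry fun r t : G => ξ t * f (t * r)) := by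
  refine IsCc.of_forall_notMem (K := (fun p : G × G => (p.1⁻¹ * p.2, p.1)) ''
    (tsupport ξ ×ˢ tsupport f)) ?_ ((hξ.2.isCompact.prod hf.2.isCompact).image (by fun_prop)) ?_
  · exact (hξ.1.comp continuous_snd).mul (hf.1.comp (by fun_prop))
  · rintro ⟨r, t⟩ h
    by_contra hne
    simp only [Function.uncurry_apply_pair, mul_eq_zero, not_or] at hne
    refine h ⟨(t, t * r), ⟨subset_tsupport _ hne.1, subset_tsupport _ hne.2⟩, ?_⟩
    simp

omit [T2Space G] in
theorem integrable_integral_norm_mul_translate_sq {ξ f : G → ℂ} (hξ : IsCc ξ) (hf : IsCc f) :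
    Integrable (fun r => ∫ t, ‖ξ t * f (t * r)‖ ^ 2 ∂(haar : Measure G)) (haar : Measure G) := by
  have := ((hξ.mul_translate_uncurry hf).normSq.integral_prod (μ := (haar : Measure G))
    (F := fun r t => ((‖ξ t * f (t * r)‖ ^ 2 : ℝ) : ℂ))).integrable (μ := (haar : Measure G))
  simp_rw [integral_complex_ofReal] at this
  simpa using this.re

-- Integrating first in r, left invariance under r ↦ tr separates the variables, so f ↦ ξ(t)f(tr)
-- scales L²-norms by ‖ξ‖.
omit [T2Space G] in
theorem integral_integral_norm_mul_translate_sq {ξ f : G → ℂ} (hξ : IsCc ξ) (hf : IsCc f) :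
    ∫ r, ∫ t, ‖ξ t * f (t * r)‖ ^ 2 ∂(haar : Measure G) ∂(haar : Measure G) =
      (∫ t, ‖ξ t‖ ^ 2 ∂(haar : Measure G)) * ∫ t, ‖f t‖ ^ 2 ∂(haar : Measure G) := by
  have h := IsCc.integral_integral_swap (μ := (haar : Measure G)) (ν := (haar : Measure G))
    (F := fun r t => ((‖ξ t * f (t * r)‖ ^ 2 : ℝ) : ℂ)) (hξ.mul_translate_uncurry hf).normSq
  simp_rw [integral_complex_ofReal] at h
  rw [Complex.ofReal_inj.1 h, ← integral_mul_const]
  refine integral_congr_ae (Filter.Eventually.of_forall fun t => ?_)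
  dsimp only
  simp_rw [norm_mul, mul_pow]
  rw [integral_const_mul, integral_mul_left_eq_self (fun r => ‖f r‖ ^ 2) t]

omit [LocallyCompactSpace G] [MeasurableSpace G] [BorelSpace G] [T2Space G] in
theorem IsCc.ccoeff_tensor_kernel {ξ η f g : G → ℂ} (hξ : IsCc ξ) (hη : IsCc η) (hf : IsCc f)
    (hg : IsCc g) : IsCc (Function.uncurry fun (p : G × G) (t : G) =>
      (ξ (p.1⁻¹ * t) * f (p.1⁻¹ * t * p.2)) * (starRingEnd ℂ) (η t * g (t * p.2))) := by
  have hξ1 := hξ.1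
  have hη1 := hη.1
  have hf1 := hf.1
  have hg1 := hg.1
  refine IsCc.of_forall_notMem (K := (fun p : G × G × G => ((p.2.1 * p.1⁻¹, p.1⁻¹ * p.2.2), p.2.1))
    '' (tsupport ξ ×ˢ tsupport η ×ˢ tsupport f)) ?_
    ((hξ.2.isCompact.prod (hη.2.isCompact.prod hf.2.isCompact)).image (by fun_prop)) ?_
  · have := Complex.continuous_conj
    unfold Function.uncurry
    fun_prop
  · rintro ⟨⟨s, r⟩, t⟩ h
    by_contra hne
    simp only [Function.uncurry_apply_pair, mul_eq_zero, not_or, map_eq_zero] at hne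
    refine h ⟨(s⁻¹ * t, t, s⁻¹ * t * r), ⟨subset_tsupport _ hne.1.1, subset_tsupport _ hne.2.1,
      subset_tsupport _ hne.1.2⟩, ?_⟩
    simp [mul_assoc]

omit [T2Space G] in
theorem IsCc.ccoeff_tensor {ξ η f g : G → ℂ} (hξ : IsCc ξ) (hη : IsCc η) (hf : IsCc f)
    (hg : IsCc g) : IsCc (Function.uncurry fun s r : G =>
      _root_.ccoeff (fun t => ξ t * f (t * r)) (fun t => η t * g (t * r)) s) :=
  (hξ.ccoeff_tensor_kernel hη hf hg).integral_prod

/-- A product of coefficients is an integral of coefficients: the absorption principle. -/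
theorem ccoeff_mul_ccoeff {ξ η f g : G → ℂ} (hξ : IsCc ξ) (hη : IsCc η) (hf : IsCc f)
    (hg : IsCc g) (s : G) : ccoeff ξ η s * ccoeff f g s =
      ∫ r, ccoeff (fun t => ξ t * f (t * r)) (fun t => η t * g (t * r)) s
        ∂(haar : Measure G) := by
  have e : IsClosedEmbedding fun p : G × G => ((s, p.1), p.2) :=
    Function.LeftInverse.isClosedEmbedding (f := fun q : (G × G) × G => (q.1.2, q.2))
      (fun _ => rfl) (by fun_prop) (by fun_prop)
  have h := (hξ.ccoeff_tensor_kernel hη hf hg).comp_isClosedEmbedding e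
  unfold ccoeff
  rw [IsCc.integral_integral_swap (F := fun r t => (ξ (s⁻¹ * t) * f (s⁻¹ * t * r)) *
    (starRingEnd ℂ) (η t * g (t * r))) h, ← integral_mul_const]
  refine integral_congr_ae (Filter.Eventually.of_forall fun t => ?_)
  dsimp only
  -- Left invariance replaces r by tr in the second coefficient.
  rw [← integral_mul_left_eq_self (fun r => f (s⁻¹ * r) * (starRingEnd ℂ) (g r)) t,
    ← integral_const_mul]
  refine integral_congr_ae (Filter.Eventually.of_forall fun r => ?_)
  simp only [map_mul, mul_assoc]
  ring

variable (H : Subgroup G) (hH : IsClosed (H : Set G)) [H.Normal]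
  [MeasurableSpace (G ⧸ H)] [BorelSpace (G ⧸ H)]

/-- The boundedness of Φ_θ, with a constant depending only on ξ and η. The functional L is a finite
sum of integrals on G so that Fubini applies, and it is general enough to represent a difference
λ(μ) - λ(f₀). The vectors being averaged keep their supports inside those of ξ and η for every r,
which makes the L²-bounds uniform. -/
theorem exists_norm_cosetAverage_mul_ccoeff_le {ξ η : G → ℂ} (hξ : IsCc ξ) (hη : IsCc η) :
    ∃ C : ℝ, 0 ≤ C ∧ ∀ (T : HaarL2 (G ⧸ H) →L[ℂ] HaarL2 (G ⧸ H)) (L : (G ⧸ H → ℂ) → ℂ)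
      {ι : Type} [Fintype ι] (m : ι → Measure G) [∀ k, IsFiniteMeasureOnCompacts (m k)]
      (v : ι → G → ℂ), (∀ k, Continuous (v k)) →
      (∀ w, IsCc w → L (cosetAverage H hH w) = ∑ k, ∫ s, v k s * w s ∂(m k)) →
      (∀ a b, inner ℂ b (T a) = L (regularCoeff a b)) →
      ∀ (f g : G → ℂ) (hf : IsCc f) (hg : IsCc g),
        ‖L (cosetAverage H hH fun s => ccoeff ξ η s * ccoeff f g s)‖ ≤
          C * ‖T‖ * (‖hf.toL2‖ ^ 2 + ‖hg.toL2‖ ^ 2) := by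
  have : IsClosed (H : Set G) := hH
  obtain ⟨κ, hκ0, hκ⟩ := exists_integral_eq_integral_cosetAverage H hH
  obtain ⟨C₁, hC₁, h₁⟩ := exists_norm_toL2_leftAverage_sq_le H hH hξ.2.isCompact
  obtain ⟨C₂, hC₂, h₂⟩ := exists_norm_toL2_cosetAverage_sq_le H hH hη.2.isCompact
  set A := ∫ t, ‖ξ t‖ ^ 2 ∂(haar : Measure G)
  set B := ∫ t, ‖η t‖ ^ 2 ∂(haar : Measure G)
  have hA : 0 ≤ A := by positivity
  have hB : 0 ≤ B := by positivity
  refine ⟨κ * (C₁ * A + C₂ * B), by positivity, fun T L ι _ m _ v hv hL hT f g hf hg => ?_⟩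
  set Ψ : G → G → ℂ := fun s r =>
    ccoeff (fun t => ξ t * f (t * r)) (fun t => η t * g (t * r)) s
  have hΨ : IsCc (Function.uncurry Ψ) := hξ.ccoeff_tensor hη hf hg
  have hΨr : ∀ r, IsCc fun s => Ψ s r := fun r =>
    (hξ.mul_translate hf r).ccoeff (hη.mul_translate hg r)
  have hvΨ : ∀ k, IsCc (Function.uncurry fun s r => v k s * Ψ s r) := fun k =>
    hΨ.mul_left ((hv k).comp continuous_fst)
  have hvΨ' : ∀ k, IsCc (Function.uncurry fun r s => v k s * Ψ s r) := fun k =>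
    (hvΨ k).comp_homeomorph (Homeomorph.prodComm G G)
  -- Absorption writes the product as an integral over r, which Fubini moves outside L.
  have hFub : L (cosetAverage H hH fun s => ccoeff ξ η s * ccoeff f g s) =
      ∫ r, L (cosetAverage H hH fun s => Ψ s r) ∂(haar : Measure G) := by
    simp_rw [ccoeff_mul_ccoeff hξ hη hf hg]
    rw [hL _ (hΨ.integral_prod (μ := (haar : Measure G)))]
    simp_rw [fun r => hL _ (hΨr r)]
    rw [integral_finsetSum _ fun k _ => ((hvΨ' k).integral_prod (μ := m k)).integrable]
    refine Finset.sum_congr rfl fun k _ => ?_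
    rw [← (hvΨ k).integral_integral_swap]
    simp_rw [integral_const_mul]
  have hΨT : ∀ r, L (cosetAverage H hH fun s => Ψ s r) =
      κ * inner ℂ ((hη.mul_translate hg r).cosetAverage H hH).toL2
        (T ((hξ.mul_translate hf r).leftAverage H hH).toL2) := by
    intro r
    have e1 : regularCoeff ((hξ.mul_translate hf r).leftAverage H hH).toL2
        ((hη.mul_translate hg r).cosetAverage H hH).toL2 =
        cosetAverage H hH fun s => (κ : ℂ)⁻¹ * Ψ s r := by
      ext y
      rw [IsCc.regularCoeff_toL2]
      rw [cosetAverage_mul_comp H hH (fun s => Ψ s r) (fun _ => (κ : ℂ)⁻¹),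
        cosetAverage_ccoeff H hH hκ (hξ.mul_translate hf r) (hη.mul_translate hg r),
        inv_mul_cancel_left₀ (by exact_mod_cast hκ0.ne')]
    rw [hT, e1, hL _ (hΨr r), hL _ ((hΨr r).mul_left continuous_const), Finset.mul_sum]
    refine Finset.sum_congr rfl fun k _ => ?_
    rw [← integral_const_mul]
    refine integral_congr_ae (Filter.Eventually.of_forall fun s => ?_)
    have : (κ : ℂ) ≠ 0 := by exact_mod_cast hκ0.ne'
    field_simp
  have hle : ∀ r, ‖L (cosetAverage H hH fun s => Ψ s r)‖ ≤ κ * ‖T‖ *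
      (C₁ * ∫ t, ‖ξ t * f (t * r)‖ ^ 2 ∂(haar : Measure G) +
        C₂ * ∫ t, ‖η t * g (t * r)‖ ^ 2 ∂(haar : Measure G)) := by
    intro r
    have e1 := h₁ _ (hξ.mul_translate hf r) fun t ht => by
      simp [image_eq_zero_of_notMem_tsupport ht]
    have e2 := h₂ _ (hη.mul_translate hg r) fun t ht => by
      simp [image_eq_zero_of_notMem_tsupport ht]
    set a := ((hξ.mul_translate hf r).leftAverage H hH).toL2
    set b := ((hη.mul_translate hg r).cosetAverage H hH).toL2
    rw [hΨT r, norm_mul, Complex.norm_real, Real.norm_of_nonneg hκ0.le, mul_assoc]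
    gcongr
    calc ‖(inner ℂ b (T a) : ℂ)‖ ≤ ‖b‖ * (‖T‖ * ‖a‖) :=
          (norm_inner_le_norm _ _).trans (by gcongr; exact T.le_opNorm a)
      _ = ‖T‖ * (‖a‖ * ‖b‖) := by ring
      _ ≤ ‖T‖ * (‖a‖ ^ 2 + ‖b‖ ^ 2) := by
          gcongr
          nlinarith [sq_nonneg (‖a‖ - ‖b‖), sq_nonneg ‖a‖, sq_nonneg ‖b‖]
      _ ≤ _ := by gcongr
  rw [hFub]
  have i1 := integrable_integral_norm_mul_translate_sq hξ hf
  have i2 := integrable_integral_norm_mul_translate_sq hη hg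
  refine (norm_integral_le_of_norm_le (((i1.const_mul C₁).add (i2.const_mul C₂)).const_mul
    (κ * ‖T‖)) (Filter.Eventually.of_forall hle)).trans ?_
  rw [integral_const_mul, integral_add' (i1.const_mul C₁) (i2.const_mul C₂), integral_const_mul,
    integral_const_mul, integral_integral_norm_mul_translate_sq hξ hf,
    integral_integral_norm_mul_translate_sq hη hg, ← hf.norm_toL2_sq, ← hg.norm_toL2_sq]
  have : C₁ * (A * ‖hf.toL2‖ ^ 2) + C₂ * (B * ‖hg.toL2‖ ^ 2) ≤
      (C₁ * A + C₂ * B) * (‖hf.toL2‖ ^ 2 + ‖hg.toL2‖ ^ 2) := by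
    have e1 : 0 ≤ C₁ * A * ‖hg.toL2‖ ^ 2 := by positivity
    have e2 : 0 ≤ C₂ * B * ‖hf.toL2‖ ^ 2 := by positivity
    nlinarith
  calc _ ≤ κ * ‖T‖ * ((C₁ * A + C₂ * B) * (‖hf.toL2‖ ^ 2 + ‖hg.toL2‖ ^ 2)) := by gcongr
    _ = _ := by ring

end Tensor

/-! ### Test functions detecting nonzero operators -/

section Group

variable {G : Type*} [Group G] [TopologicalSpace G] [IsTopologicalGroup G] [LocallyCompactSpace G]
  [MeasurableSpace G] [BorelSpace G]

/-- If χ = 1 on K · supp f, then for s ∈ K the coefficient of f and χ is ∫ f, which is then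
normalised to 1. -/
theorem exists_regularCoeff_eq_one [T2Space G] {K : Set G} (hK : IsCompact K) :
    ∃ a b : HaarL2 G, ∀ s ∈ K, regularCoeff a b s = 1 := by
  obtain ⟨f, hfs, hf0, hf1⟩ := exists_continuous_nonneg_pos (1 : G)
  obtain ⟨χ, hχ1, hχs, -, -⟩ := exists_continuousMap_one_of_isCompact_subset_isOpen
    (hK.mul hfs.isCompact) isOpen_univ (Set.subset_univ _)
  have hf := isCc_ofReal f.continuous hfs
  have hχ := isCc_ofReal χ.continuous hχs
  have hpos : 0 < ∫ t, f t ∂(haar : Measure G) :=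
    f.continuous.integral_pos_of_hasCompactSupport_nonneg_nonzero hfs hf0 hf1
  refine ⟨((∫ t, f t ∂(haar : Measure G) : ℝ) : ℂ)⁻¹ • hf.toL2, hχ.toL2, fun s hs => ?_⟩
  rw [regularCoeff_smul_left, hf.regularCoeff_toL2 hχ]
  have h1 : ccoeff (fun x => (f x : ℂ)) (fun x => (χ x : ℂ)) s =
      ((∫ t, f t ∂(haar : Measure G) : ℝ) : ℂ) := by
    rw [← integral_complex_ofReal,
      ← integral_mul_left_eq_self (fun t => ((f t : ℝ) : ℂ)) s⁻¹]
    refine integral_congr_ae (Filter.Eventually.of_forall fun t => ?_)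
    dsimp only
    by_cases ht : s⁻¹ * t ∈ tsupport f
    · have : χ t = 1 := hχ1 ⟨s, hs, s⁻¹ * t, ht, by simp⟩
      simp [this]
    · simp [image_eq_zero_of_notMem_tsupport ht]
  rw [h1, inv_mul_cancel₀ (by exact_mod_cast hpos.ne')]

theorem IsCc.toL2_mem_span {f : G → ℂ} (hf : IsCc f) :
    hf.toL2 ∈ Submodule.span ℂ {v : HaarL2 G | ∃ (r : G → ℝ) (hr : Continuous r)
      (hrs : HasCompactSupport r), (∀ x, 0 ≤ r x) ∧ v = (isCc_ofReal hr hrs).toL2} := by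
  set D := {v : HaarL2 G | ∃ (r : G → ℝ) (hr : Continuous r)
      (hrs : HasCompactSupport r), (∀ x, 0 ≤ r x) ∧ v = (isCc_ofReal hr hrs).toL2}
  have key : ∀ q : ℂ → ℝ, ∀ hq : Continuous q, ∀ hq0 : q 0 = 0,
      (isCc_ofReal (hq.comp hf.1) (hf.2.comp_left (g := q) hq0)).toL2 ∈ Submodule.span ℂ D := by
    intro q hq hq0
    have hp : ∀ g : ℝ → ℝ, Continuous g → g 0 = 0 → (∀ x, 0 ≤ g x) →
        ∃ h : IsCc fun x => ((g (q (f x)) : ℝ) : ℂ), h.toL2 ∈ Submodule.span ℂ D := by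
      intro g hg hg0 hgn
      have hc : Continuous fun x => g (q (f x)) := hg.comp (hq.comp hf.1)
      have hs : HasCompactSupport fun x => g (q (f x)) :=
        hf.2.comp_left (g := fun z => g (q z)) (by simp [hq0, hg0])
      exact ⟨isCc_ofReal hc hs, Submodule.subset_span ⟨_, hc, hs, fun x => hgn _, rfl⟩⟩
    obtain ⟨h1, m1⟩ := hp (fun r => max r 0) (by fun_prop) (by simp) fun x => le_max_right _ _
    obtain ⟨h2, m2⟩ := hp (fun r => max (-r) 0) (by fun_prop) (by simp) fun x => le_max_right _ _
    convert! Submodule.sub_mem _ m1 m2 using 1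
    rw [IsCc.toL2, IsCc.toL2, IsCc.toL2, ← MemLp.toLp_sub]
    congr 1
    ext x
    simp only [Pi.sub_apply, Function.comp_apply]
    rw [← Complex.ofReal_sub]
    congr 1
    rcases le_total 0 (q (f x)) with h | h
    · rw [max_eq_left h, max_eq_right (by linarith)]; ring
    · rw [max_eq_right h, max_eq_left (by linarith)]; ring
  have h1 := key Complex.re Complex.continuous_re rfl
  have h2 := key Complex.im Complex.continuous_im rfl
  convert! Submodule.add_mem _ h1 (Submodule.smul_mem _ Complex.I h2) using 1
  rw [IsCc.toL2, IsCc.toL2, IsCc.toL2, ← MemLp.toLp_const_smul, ← MemLp.toLp_add]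
  congr 1
  ext x
  simp only [Pi.add_apply, Pi.smul_apply, Function.comp_apply, smul_eq_mul]
  rw [mul_comm, Complex.re_add_im]

/-- Nonnegative functions of C_c span a dense subspace of L². Nonnegativity here is what later makes
θ ≥ 0 possible. -/
theorem exists_inner_nonneg_ne_zero [T2Space G] {T : HaarL2 G →L[ℂ] HaarL2 G} (hT : T ≠ 0) :
    ∃ (a b : G → ℝ) (ha : Continuous a) (has : HasCompactSupport a) (hb : Continuous b)
      (hbs : HasCompactSupport b), (∀ x, 0 ≤ a x) ∧ (∀ x, 0 ≤ b x) ∧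
      (inner ℂ (isCc_ofReal hb hbs).toL2 (T (isCc_ofReal ha has).toL2) : ℂ) ≠ 0 := by
  by_contra! hcon
  refine hT (norm_le_zero_iff.1 ((opNorm_le_of_dense_quadratic_bound T dense_isCc_toL2 le_rfl
    ?_).trans_eq (mul_zero 2)))
  rintro _ ⟨f, hf, rfl⟩ _ ⟨g, hg, rfl⟩
  suffices h : (inner ℂ hg.toL2 (T hf.toL2) : ℂ) = 0 by simp [h]
  refine Submodule.span_induction (p := fun y _ => (inner ℂ y (T hf.toL2) : ℂ) = 0) ?_ (by simp)
    (fun x y _ _ hx hy => by rw [inner_add_left, hx, hy, add_zero])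
    (fun c x _ hx => by rw [inner_smul_left, hx, mul_zero]) hg.toL2_mem_span
  rintro _ ⟨b, hb, hbs, hb0, rfl⟩
  refine Submodule.span_induction (p := fun x _ => (inner ℂ _ (T x) : ℂ) = 0) ?_ (by simp)
    (fun x y _ _ hx hy => by rw [map_add, inner_add_right, hx, hy, add_zero])
    (fun c x _ hx => by rw [map_smul, inner_smul_right, hx, mul_zero]) hf.toL2_mem_span
  rintro _ ⟨a, ha, has, ha0, rfl⟩
  exact hcon a b ha has hb hbs ha0 hb0

end Group

/-! ### Choice of θ and transfer to the reduced C⋆-algebra of G -/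

section Transfer

variable {G : Type*} [Group G] [TopologicalSpace G] [IsTopologicalGroup G] [LocallyCompactSpace G]
  [MeasurableSpace G] [BorelSpace G] [T2Space G] (H : Subgroup G) (hH : IsClosed (H : Set G))
  [H.Normal] [MeasurableSpace (G ⧸ H)] [BorelSpace (G ⧸ H)]

omit [T2Space G] in
theorem integrable_regularCoeff {p : Measure G} [IsFiniteMeasure p] (a b : HaarL2 G) :
    Integrable (regularCoeff a b) p := by
  simpa using integrable_mul_regularCoeff (p := p) (integrable_const (1 : ℂ)) a b

omit [T2Space G] in
theorem ccoeff_ofReal {a b : G → ℝ} (ha0 : ∀ x, 0 ≤ a x) (hb0 : ∀ x, 0 ≤ b x) (s : G) :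
    0 ≤ (ccoeff (fun x => (a x : ℂ)) (fun x => (b x : ℂ)) s).re ∧
    (((ccoeff (fun x => (a x : ℂ)) (fun x => (b x : ℂ)) s).re : ℝ) : ℂ) =
      ccoeff (fun x => (a x : ℂ)) (fun x => (b x : ℂ)) s := by
  have h : ccoeff (fun x => (a x : ℂ)) (fun x => (b x : ℂ)) s =
      ((∫ t, a (s⁻¹ * t) * b t ∂(haar : Measure G) : ℝ) : ℂ) := by
    rw [← integral_complex_ofReal]
    simp [ccoeff]
  rw [h, Complex.ofReal_re]
  exact ⟨integral_nonneg fun t => mul_nonneg (ha0 _) (hb0 _), rfl⟩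

/-- Some coefficient `θ` of nonnegative functions has an average which is not annihilated by a
given functional with nonzero operator. -/
theorem exists_ccoeff_cosetAverage_ne_zero {T : HaarL2 (G ⧸ H) →L[ℂ] HaarL2 (G ⧸ H)} (hT : T ≠ 0)
    {L : (G ⧸ H → ℂ) → ℂ} (hmul : ∀ (c : ℂ) (v : G ⧸ H → ℂ), IsCc v →
      L (fun y => c * v y) = c * L v) (hLT : ∀ a b, inner ℂ b (T a) = L (regularCoeff a b)) :
    ∃ ξ η : G → ℝ, (IsCc fun x => (ξ x : ℂ)) ∧ (IsCc fun x => (η x : ℂ)) ∧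
      (∀ x, 0 ≤ ξ x) ∧ (∀ x, 0 ≤ η x) ∧
      L (cosetAverage H hH (ccoeff (fun x => (ξ x : ℂ)) fun x => (η x : ℂ))) ≠ 0 := by
  have : IsClosed (H : Set G) := hH
  obtain ⟨κ, hκ0, hκ⟩ := exists_integral_eq_integral_cosetAverage H hH
  obtain ⟨a, b, ha, has, hb, hbs, ha0, hb0, hne⟩ := exists_inner_nonneg_ne_zero hT
  -- A left average is the coset average of the inverted function at the inverse point, so the
  -- inverse of a is lifted; x ↦ ξ(x⁻¹) then has left average a.
  obtain ⟨ξ, hξ, hξs, hξ0, hξa⟩ := exists_cosetAverage_eq H hH (g := fun y => a y⁻¹)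
    (ha.comp continuous_inv) (has.comp_homeomorph (Homeomorph.inv (G ⧸ H))) fun y => ha0 _
  obtain ⟨η, hη, hηs, hη0, hηb⟩ := exists_cosetAverage_eq H hH hb hbs hb0
  have hξC : IsCc fun x => ((ξ x⁻¹ : ℝ) : ℂ) :=
    (isCc_ofReal hξ hξs).comp_homeomorph (Homeomorph.inv G)
  have hηC := isCc_ofReal hη hηs
  refine ⟨fun x => ξ x⁻¹, η, hξC, hηC, fun x => hξ0 _, hη0, ?_⟩
  have h1 : leftAverage H hH (fun x => ((ξ x⁻¹ : ℝ) : ℂ)) = fun y => (a y : ℂ) := by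
    ext y
    simp [leftAverage, hξa]
  have h2 : cosetAverage H hH (fun x => (η x : ℂ)) = fun y => (b y : ℂ) := funext hηb
  have h3 : cosetAverage H hH (ccoeff (fun x => ((ξ x⁻¹ : ℝ) : ℂ)) fun x => (η x : ℂ)) =
      fun y => (κ : ℂ) * ccoeff (fun y => (a y : ℂ)) (fun y => (b y : ℂ)) y := by
    ext y
    rw [cosetAverage_ccoeff H hH hκ hξC hηC, h1, h2]
  have haC := isCc_ofReal ha has
  have hbC := isCc_ofReal hb hbs
  rw [h3, hmul _ _ (haC.ccoeff hbC), ← haC.regularCoeff_toL2 hbC, ← hLT]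
  exact mul_ne_zero (by exact_mod_cast hκ0.ne') hne

/-- The operator of the transferred measure belongs to the reduced group C⋆-algebra. -/
theorem mem_reducedCStar_of_inner_eq {ι : Type} [Fintype ι] (p : ι → Measure (G ⧸ H))
    [∀ k, IsFiniteMeasure (p k)] (c : ι → ℂ) {T : HaarL2 (G ⧸ H) →L[ℂ] HaarL2 (G ⧸ H)}
    (hT : T ∈ reducedCStar (G ⧸ H))
    (hTp : ∀ a b, inner ℂ b (T a) = ∑ k, c k * ∫ y, regularCoeff a b y ∂(p k))
    {ξ η : G → ℂ} (hξ : IsCc ξ) (hη : IsCc η) {S : HaarL2 G →L[ℂ] HaarL2 G}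
    (hS : ∀ a b, inner ℂ b (S a) = ∑ k, c k *
      ∫ y, cosetAverage H hH (fun s => ccoeff ξ η s * regularCoeff a b s) y ∂(p k)) :
    S ∈ reducedCStar G := by
  have : IsClosed (H : Set G) := hH
  obtain ⟨κ, hκ0, hκ⟩ := exists_integral_eq_integral_cosetAverage H hH
  have hκC : (κ : ℂ) ≠ 0 := by exact_mod_cast hκ0.ne'
  obtain ⟨C, hC0, hC⟩ := exists_norm_cosetAverage_mul_ccoeff_le H hH hξ hη
  refine Metric.mem_closure_iff.2 fun ε hε => ?_
  -- The transport has norm at most 2C on T - T'; the added 1 keeps the denominator positive when C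
  -- = 0.
  obtain ⟨f₀, T', hf₀, hT', hlt⟩ := exists_isCc_norm_sub_lt_of_mem_reducedCStar hT
    (ε := ε / (2 * C + 1)) (by positivity)
  have hθ := hξ.ccoeff hη
  have hf₀q : Continuous fun s : G => f₀ s := hf₀.1.comp QuotientGroup.continuous_mk
  have hw₀ : IsCc fun s : G => (κ : ℂ)⁻¹ * f₀ s * ccoeff ξ η s :=
    hθ.mul_left (continuous_const.mul hf₀q)
  have hw₀I : Integrable (fun s : G => (κ : ℂ)⁻¹ * f₀ s * ccoeff ξ η s) haar := hw₀.integrable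
  obtain ⟨S', hS'⟩ := exists_clm_integral_mul_regularCoeff hw₀I
  refine ⟨S', ⟨_, hw₀I, hS'⟩, ?_⟩
  -- Weil's formula identifies Φ_θ(λ(f₀)) with λ of the integrable function κ⁻¹ (f₀ ∘ q) θ.
  have hf₀w : ∀ w : G → ℂ, IsCc w → ∫ y, f₀ y * cosetAverage H hH w y ∂(haar : Measure (G ⧸ H)) =
      ∫ s, (κ : ℂ)⁻¹ * f₀ s * w s ∂(haar : Measure G) := by
    intro w hw
    simp_rw [mul_assoc, integral_const_mul, hκ _ (hw.mul_left hf₀q)]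
    rw [inv_mul_cancel_left₀ hκC]
    refine integral_congr_ae (Filter.Eventually.of_forall fun y => ?_)
    exact (cosetAverage_mul_comp H hH w f₀ y).symm
  let L : (G ⧸ H → ℂ) → ℂ := fun v =>
    ∑ k, c k * ∫ y, v y ∂(p k) - ∫ y, f₀ y * v y ∂(haar : Measure (G ⧸ H))
  choose m hmreg hm using fun k => exists_measure_integral_eq_integral_cosetAverage H hH (p k)
    (ρ := fun _ => 1) continuous_const fun _ => zero_le_one
  -- The index `none` carries the term of f₀ through Haar measure; the other indices carry the lifts
  -- of the p k with ρ = 1.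
  let m' : Option ι → Measure G := fun k => k.elim haar m
  have : ∀ k, IsFiniteMeasureOnCompacts (m' k) := fun k => by
    cases k with
    | none => exact inferInstanceAs (IsFiniteMeasureOnCompacts (haar : Measure G))
    | some k => have := hmreg k; exact inferInstanceAs (IsFiniteMeasureOnCompacts (m k))
  have key := hC (T - T') L m' (fun k => k.elim (fun s : G => -((κ : ℂ)⁻¹ * f₀ s)) fun k _ => c k)
    (fun k => by
      cases k with
      | none => exact (continuous_const.mul hf₀q).neg
      | some k => exact continuous_const) (fun w hw => by
      rw [Fintype.sum_option]
      simp only [L, m', Option.elim_none, Option.elim_some]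
      rw [hf₀w w hw, sub_eq_neg_add, ← integral_neg]
      simp only [neg_mul, integral_const_mul]
      congr 1
      refine Finset.sum_congr rfl fun k _ => ?_
      rw [hm k w hw]
      simp) (fun a b => by
      rw [_root_.sub_apply, inner_sub_right, hTp, hT'])
  have hle : ‖S - S'‖ ≤ 2 * (C * ‖T - T'‖) := by
    refine opNorm_le_of_dense_quadratic_bound _ dense_isCc_toL2 (by positivity) ?_
    rintro _ ⟨f, hf, rfl⟩ _ ⟨g, hg, rfl⟩
    refine le_trans (le_of_eq ?_) (key f g hf hg)
    rw [_root_.sub_apply, inner_sub_right, hS, hS', hf.regularCoeff_toL2 hg]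
    simp only [L]
    rw [hf₀w _ ((hf.ccoeff hg).mul_left hθ.1)]
    simp only [mul_assoc]
  rw [dist_eq_norm]
  have h0 : 0 < 2 * C + 1 := by positivity
  rw [lt_div_iff₀ h0] at hlt
  nlinarith [norm_nonneg (T - T')]

end Transfer

/-! ### The main theorem -/

theorem theorem3p9 {G : Type*} [Group G] [TopologicalSpace G] [IsTopologicalGroup G]
    [LocallyCompactSpace G] [T2Space G] [MeasurableSpace G] [BorelSpace G]
    (H : Subgroup G) [H.Normal] (hH : IsClosed (H : Set G))
    [MeasurableSpace (G ⧸ H)] [BorelSpace (G ⧸ H)] [SecondCountableTopology (G ⧸ H)]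
    (hcomm : ∀ a b : G ⧸ H, a * b = b * a)
    (hl : HasPropertyLSq H hH)
    (E : Set (G ⧸ H)) (hE : IsCompact E) (hM : IsM0Set E) :
    IsM0Set ((QuotientGroup.mk : G → G ⧸ H) ⁻¹' E) ∧
      ∃ μ : ComplexMeasure (G ⧸ H), IsM0Witness E μ ∧
      ∃ θ ∈ fourierAlgebra G, Continuous θ ∧ HasCompactSupport θ ∧
      ∃ ν : ComplexMeasure G, IsM0Witness ((QuotientGroup.mk : G → G ⧸ H) ⁻¹' E) ν ∧
        ∀ u ∈ fourierAlgebra G,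
          cintegral ν u = cintegral μ (cosetAverage H hH (fun y => θ y * u y)) := by
  have : IsClosed (H : Set G) := hH
  obtain ⟨hEc, μ, hμ⟩ := hM
  suffices h : ∃ θ ∈ fourierAlgebra G, Continuous θ ∧ HasCompactSupport θ ∧
      ∃ ν : ComplexMeasure G, IsM0Witness ((QuotientGroup.mk : G → G ⧸ H) ⁻¹' E) ν ∧
        ∀ u ∈ fourierAlgebra G,
          cintegral ν u = cintegral μ (cosetAverage H hH (fun y => θ y * u y)) by
    obtain ⟨θ, hθA, hθc, hθs, ν, hν, h⟩ := h
    exact ⟨⟨hEc.preimage QuotientGroup.continuous_mk, ν, hν⟩, μ, hμ, θ, hθA, hθc, hθs, ν, hν, h⟩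
  obtain ⟨⟨hμreg, hμE⟩, T, hTmem, hTμ, hT0⟩ := hμ
  -- By regularity the complement of the support is null, which passes to each p k.
  have hμEc : μ.variation Eᶜ = 0 :=
    measure_mono_null (Set.compl_subset_compl.2 hμE) measure_compl_support_of_regular
  obtain ⟨p, hp, c, hc, hpμ, rfl⟩ := exists_eq_sum_scaledMeasure μ
  have hcc : ∀ {v : G ⧸ H → ℂ}, IsCc v →
      cintegral (∑ k, scaledMeasure (p k) (c k)) v = ∑ k, c k * ∫ y, v y ∂(p k) := fun hv =>
    cintegral_sum_scaledMeasure p hc fun k => hv.integrable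
  obtain ⟨ξ, η, hξ, hη, hξ0, hη0, hne⟩ := exists_ccoeff_cosetAverage_ne_zero H hH hT0
    (L := cintegral (∑ k, scaledMeasure (p k) (c k))) (fun a v hv => by
      rw [hcc hv, hcc (hv.mul_left continuous_const), Finset.mul_sum]
      refine Finset.sum_congr rfl fun k _ => ?_
      rw [integral_const_mul]
      ring) hTμ
  set θ : G → ℂ := ccoeff (fun x => (ξ x : ℂ)) fun x => (η x : ℂ)
  have hθ : IsCc θ := hξ.ccoeff hη
  have hθre : ∀ s, (((θ s).re : ℝ) : ℂ) = θ s := fun s => (ccoeff_ofReal hξ0 hη0 s).2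
  refine ⟨θ, ⟨hξ.toL2, hη.toL2, (hξ.regularCoeff_toL2 hη).symm⟩, hθ.1, hθ.2, ?_⟩
  -- Since θ is real and nonnegative, its real part serves as the weight ρ.
  choose n hnreg hnfin hnnull hn using fun k =>
    exists_finite_measure_integral_eq_integral_cosetAverage H hH (p k)
      (Complex.continuous_re.comp hθ.1) (hθ.2.comp_left (g := Complex.re) rfl)
      fun s => (ccoeff_ofReal hξ0 hη0 s).1
  simp only [Function.comp_apply, hθre] at hn
  have hν : ∀ a b : HaarL2 G, cintegral (∑ k, scaledMeasure (n k) (c k)) (regularCoeff a b) =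
      ∑ k, c k * ∫ y, cosetAverage H hH (fun s => θ s * regularCoeff a b s) y ∂(p k) := by
    intro a b
    rw [cintegral_sum_scaledMeasure n hc fun k => integrable_regularCoeff a b]
    simp_rw [fun k => hn k _ (continuous_regularCoeff a b)]
  have hνμ : ∀ u ∈ fourierAlgebra G, cintegral (∑ k, scaledMeasure (n k) (c k)) u =
      cintegral (∑ k, scaledMeasure (p k) (c k)) (cosetAverage H hH fun s => θ s * u s) := by
    rintro _ ⟨a, b, rfl⟩
    rw [hν, hcc ((hθ.mul_right (continuous_regularCoeff a b)).cosetAverage H hH)]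
  obtain ⟨S, hS⟩ := exists_isRegularOp_sum_scaledMeasure n hc
  have hvar := variation_sum_scaledMeasure_le n hc
  refine ⟨∑ k, scaledMeasure (n k) (c k), ⟨⟨?_, ?_⟩, S, ?_, hS, ?_⟩, hνμ⟩
  · exact Measure.Regular.of_le_of_isFiniteMeasure hvar
  · refine support_subset_of_isClosed (hEc.preimage QuotientGroup.continuous_mk) ?_
    refine mem_ae_iff.2 (le_antisymm ((hvar _).trans_eq ?_) zero_le)
    rw [Measure.finsetSum_apply]
    exact Finset.sum_eq_zero fun k _ => hnnull k _ hEc.isOpen_compl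
      (le_antisymm ((hpμ k _).trans_eq hμEc) zero_le)
  · exact mem_reducedCStar_of_inner_eq H hH p c hTmem (fun a b => by
      rw [hTμ, cintegral_sum_scaledMeasure p hc fun k => integrable_regularCoeff a b]) hξ hη
      fun a b => by rw [hS, hν]
  · rintro rfl
    -- If λ(ν) = 0, testing ν on a coefficient equal to 1 on the support of θ would give ∫ φ(θ) dμ =
    -- 0, against the choice of θ.
    obtain ⟨a, b, hab⟩ := exists_regularCoeff_eq_one (G := G) hθ.2.isCompact
    have h1 := hνμ _ ⟨a, b, rfl⟩
    rw [← hS] at h1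
    have h2 : (fun s => θ s * regularCoeff a b s) = θ := by
      ext s
      by_cases hs : s ∈ tsupport θ
      · rw [hab s hs, mul_one]
      · rw [image_eq_zero_of_notMem_tsupport hs, zero_mul]
    rw [h2] at h1
    exact hne (h1.symm.trans (by simp))
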